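/- Let $[x_0:\dots:x_6]$ be homogeneous coordinates on $\mathbb P^6=\mathbb P(\mathbb C^7)$ and let $$f=\sum_{i=2}^6x_i^4+x_0^3x_2+x_1^3x_3+x_0^2x_1x_4+x_0x_1^2x_5+x_0^2x_2^2+x_1^2x_3^2+(x_0^2+x_0x_1+x_1^2)x_6^2+x_0x_4^3+x_1x_5^3+(x_0+x_1)x_6^3,$$ a non-zero form of degree $4$, invariant under the involution of the coordinates that exchanges $x_0\leftrightarrow x_1$, $x_2\leftrightarrow x_3$, $x_4\leftrightarrow x_5$. Then $\ell=\{x_2=\dots=x_6=0\}$ is a projective line on the quartic hypersurface $X=Z(f)\subset\mathbb P^6$. For $x\in\ell$ let $\mathcal C_x\subset\mathbb P T_xX$ be the variety of tangent directions at $x$ of the lines on $X$ that pass through $x$ (its germ at $\ell_x$ is the VMRT), and let $\ell_x=\mathbb P T_x\ell\in\mathcal C_x$. Then: 1. $X$ is smooth along $\ell$. 2. The normal bundle $N_\ell=TX|_\ell/T\ell$ of $\ell\subset X$ is isomorphic to $\mathcal O(1)\oplus\mathcal O^{\oplus 3}$. 3. For all $x\in\ell$, the germ of $\mathcal C_x$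 at $\ell_x$ is a complex submanifold of $\mathbb P T_xX$ of dimension $1$, the second fundamental form $\mathrm{FF}^2_{\ell_x,\mathcal C_x}:\mathrm{Sym}^2(T_{\ell_x}\mathcal C_x)\to T_{\ell_x}\mathbb P T_xX/T_{\ell_x}\mathcal C_x$ is defined, and it is nonzero. 4. For all $x\in\ell$, the third fundamental form $\mathrm{FF}^3_{\ell_x,\mathcal C_x}:\mathrm{Sym}^3(T_{\ell_x}\mathcal C_x)\to T_{\ell_x}\mathbb P T_xX/T^{(2)}_{\ell_x}\mathcal C_x$ is defined and nonzero. 5. At $P=[1:1:0:\dots:0]\in\ell$, the fourth fundamental form $\mathrm{FF}^4_{\ell_P,\mathcal C_P}:\mathrm{Sym}^4(T_{\ell_P}\mathcal C_P)\to T_{\ell_P}\mathbb P T_PX/T^{(3)}_{\ell_P}\mathcal C_P$ is defined and nonzero, and $\mathcal C_P$ is linearly nondegenerate in $\mathbb P T_PX$: no neighborhood of $\ell_P$ in $\mathcal C_P$ is contained in a hyperplane. Here, for a complex submanifold $Z\subset\mathbb PW$ with affine cone $\hat Z\subset W$, the $k$-th fundamental form at $z=[p]$ sends $(u_1,\dots,u_k)$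 to the class of the image in $T_z\mathbb PW$ of the vector $\hat v_k(\hat v_{k-1}\cdots\hat v_2(\hat v_1))$ at $p$, modulo the osculating space $T^{(k-1)}_zZ$, where the $\hat v_i$ are holomorphic vector fields on $W$ near $p$ which are tangent to $\hat Z$ and whose values at $p$ map to $u_i\in T_zZ$; $T^{(1)}_zZ=T_zZ$, and $T^{(k)}_zZ$ is the preimage in $T_z\mathbb PW$ of the span of the image of the $k$-th form. It is defined at the points $z$ near which $T^{(1)}Z,\dots,T^{(k-1)}Z$ have constant rank. -/

import Mathlib

open scoped LinearAlgebra.Projectivization Topology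

noncomputable section

namespace LinesOnHypersurfaces

open Module Submodule

/-! ### Tangent spaces of projective spaces

For `x` in `ℙ V`, write `x̂ ⊆ V` for the line `x.submodule`. Then `T_x ℙ V = Hom(x̂, V / x̂)`. -/

section TangentSpaces

variable {V : Type*} [NormedAddCommGroup V] [NormedSpace ℂ V]

instance isClosed_submodule (x : ℙ ℂ V) : IsClosed (x.submodule : Set V) :=
  x.submodule.closed_of_finiteDimensional

/-- The tangent space `T_x ℙ V = Hom(x̂, V / x̂)` of the projective space `ℙ V` at `x`. -/
def TP (x : ℙ ℂ V) : Type _ := x.submodule →L[ℂ] (V ⧸ x.submodule)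

instance (x : ℙ ℂ V) : NormedAddCommGroup (TP x) :=
  inferInstanceAs (NormedAddCommGroup (x.submodule →L[ℂ] (V ⧸ x.submodule)))

instance (x : ℙ ℂ V) : NormedSpace ℂ (TP x) :=
  inferInstanceAs (NormedSpace ℂ (x.submodule →L[ℂ] (V ⧸ x.submodule)))

instance (x : ℙ ℂ V) : FunLike (TP x) x.submodule (V ⧸ x.submodule) :=
  inferInstanceAs (FunLike (x.submodule →L[ℂ] (V ⧸ x.submodule)) x.submodule (V ⧸ x.submodule))

instance (x : ℙ ℂ V) : ContinuousLinearMapClass (TP x) ℂ x.submodule (V ⧸ x.submodule) :=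
  inferInstanceAs (ContinuousLinearMapClass (x.submodule →L[ℂ] (V ⧸ x.submodule)) ℂ x.submodule
    (V ⧸ x.submodule))

/-- For a linear subspace `S` of `V` containing `x̂`, the subspace `Hom(x̂, S / x̂)` of
`T_x ℙ V = Hom(x̂, V / x̂)`. If `S` is the affine tangent space `T̂_x Y` of a submanifold `Y` of
`ℙ V`, this is the tangent space `T_x Y`. -/
def homTo (x : ℙ ℂ V) (S : Submodule ℂ V) : Submodule ℂ (TP x) where
  carrier := {θ | ∀ p : x.submodule, θ p ∈ S.map x.submodule.mkQ}
  add_mem' ha hb p := add_mem (ha p) (hb p)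
  zero_mem' _ := zero_mem _
  smul_mem' c _ ha p := smul_mem _ c (ha p)

/-- If `S ⊇ x̂` has dimension two, then `ℙ S` is a projective line through `x`, and its tangent
space at `x` is one-dimensional. -/
theorem finrank_homTo (x : ℙ ℂ V) (S : Submodule ℂ V) (hS : finrank ℂ S = 2)
    (hx : x.submodule ≤ S) : finrank ℂ (homTo x S) = 1 := by
  have hfin : FiniteDimensional ℂ S := FiniteDimensional.of_finrank_pos (by omega)
  let p : x.submodule := ⟨x.rep, by rw [x.submodule_eq]; exact mem_span_singleton_self _⟩
  have hp : p ≠ 0 := fun h => x.rep_nonzero (congrArg Subtype.val h)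
  have hspan : ∀ q : x.submodule, ∃ c : ℂ, c • p = q := by
    rintro ⟨q, hq⟩
    rw [x.submodule_eq, mem_span_singleton] at hq
    obtain ⟨c, rfl⟩ := hq
    exact ⟨c, rfl⟩
  let ev : homTo x S →ₗ[ℂ] (S.map x.submodule.mkQ) :=
    { toFun := fun θ => ⟨θ.1 p, θ.2 p⟩
      map_add' := fun _ _ => rfl
      map_smul' := fun _ _ => rfl }
  have hinj : Function.Injective ev := by
    intro θ η h
    have h' : θ.1 p = η.1 p := congrArg Subtype.val h
    apply Subtype.ext
    refine DFunLike.ext _ _ fun q => ?_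
    obtain ⟨c, rfl⟩ := hspan q
    rw [map_smul, map_smul, h']
  have hsurj : Function.Surjective ev := by
    rintro ⟨w, hw⟩
    obtain ⟨φ, hφ⟩ := LinearMap.exists_extend
      (p := ℂ ∙ p) ((LinearMap.toSpanSingleton ℂ (V ⧸ x.submodule) w).comp
        (LinearEquiv.toSpanNonzeroSingleton ℂ _ p hp).symm.toLinearMap)
    have hφp : φ p = w := by
      have := LinearMap.congr_fun hφ ⟨p, mem_span_singleton_self p⟩
      simp only [LinearMap.comp_apply, Submodule.subtype_apply, LinearEquiv.coe_coe] at this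
      rw [this]
      have h1 : (LinearEquiv.toSpanNonzeroSingleton ℂ _ p hp).symm
          ⟨p, mem_span_singleton_self p⟩ = 1 := by
        rw [LinearEquiv.symm_apply_eq]
        simp
      rw [h1]; simp
    refine ⟨⟨LinearMap.toContinuousLinearMap φ, fun q => ?_⟩, Subtype.ext hφp⟩
    obtain ⟨c, rfl⟩ := hspan q
    change φ (c • p) ∈ _
    rw [map_smul, hφp]
    exact smul_mem _ c hw
  rw [(LinearEquiv.ofBijective ev ⟨hinj, hsurj⟩).finrank_eq]
  let m : S →ₗ[ℂ] (V ⧸ x.submodule) := x.submodule.mkQ.comp S.subtype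
  have hr : LinearMap.range m = S.map x.submodule.mkQ := by
    rw [LinearMap.range_comp, range_subtype]
  have hk : finrank ℂ (LinearMap.ker m) = 1 := by
    have : LinearMap.ker m = x.submodule.submoduleOf S := by
      rw [LinearMap.ker_comp, ker_mkQ]; rfl
    rw [this, (submoduleOfEquivOfLe hx).finrank_eq, x.finrank_submodule]
  have := LinearMap.finrank_range_add_finrank_ker m
  rw [hr, hk, hS] at this
  omega

end TangentSpaces

/-! ### Fundamental forms of submanifolds of a projective space -/

section FundamentalForms

variable {W : Type*} [NormedAddCommGroup W] [NormedSpace ℂ W]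

/-- The affine cone `Ẑ ⊆ W` over `Z ⊆ ℙ W`: the union of the lines that are the points of `Z`. -/
def affineCone (Z : Set (ℙ ℂ W)) : Set W := {p | ∃ z ∈ Z, p ∈ z.submodule}

/-- `Z ⊆ ℙ W` is a `d`-dimensional complex submanifold near its point `z`. As `W ∖ 0 → ℙ W` is a
`ℂ*`-bundle, this says that `Ẑ` is a `(d + 1)`-dimensional complex submanifold of `W` near the
non-zero points of `ẑ`, that is, locally the zero set of a holomorphic submersion whose fibers have
dimension `d + 1`. -/
def IsSubmanifoldAt (Z : Set (ℙ ℂ W)) (z : ℙ ℂ W) (d : ℕ) : Prop :=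
  z ∈ Z ∧ ∀ p ∈ z.submodule, p ≠ 0 → ∃ (m : ℕ) (g : W → Fin m → ℂ),
    AnalyticAt ℂ g p ∧ Function.Surjective (fderiv ℂ g p) ∧
    finrank ℂ (LinearMap.ker (fderiv ℂ g p).toLinearMap) = d + 1 ∧
    ∀ᶠ q in 𝓝 p, q ∈ affineCone Z ↔ g q = 0

/-- The tangent space at `p` of a complex submanifold `A` of `W`: it consists of the velocities of
holomorphic curves in `A` through `p`. (For a submanifold the velocities already form a linear
subspace, so that the span adds nothing.) -/
def tangentSpan (A : Set W) (p : W) : Submodule ℂ W :=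
  span ℂ {w | ∃ c : ℂ → W, AnalyticAt ℂ c 0 ∧ c 0 = p ∧ (∀ᶠ s in 𝓝 0, c s ∈ A) ∧ deriv c 0 = w}

/-- `v` is (the germ at `p` of) a holomorphic vector field on `W` that is tangent to `A`. -/
def IsTangentField (A : Set W) (p : W) (v : W → W) : Prop :=
  AnalyticAt ℂ v p ∧ ∀ᶠ q in 𝓝[A] p, v q ∈ tangentSpan A q

/-- The iterated derivative `v_k (v_{k-1} ⋯ v_2 (v_1))` of vector fields on `W` (here the
fields are numbered from `0` to `k - 1`), that is, the field of which each coordinate is obtained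
by applying the derivations `v_1, …, v_k` in this order to the coordinate function. -/
def iterDeriv : (k : ℕ) → (Fin k → W → W) → W → W
  | 0, _ => id
  | k + 1, v => fun p => fderiv ℂ (iterDeriv k fun i => v i.castSucc) p (v (Fin.last k) p)

/-- The affine osculating space `T̂^{(k)} Z ⊆ W` of `Z ⊆ ℙ W` at a non-zero vector `p`
of the cone. It is built inductively from `T̂^{(0)} = ℂ p` by adding the values at `p` of all
`v_k (v_{k-1} ⋯ v_2 (v_1))`, with `v_i` tangent to `Ẑ`. -/
def osc (Z : Set (ℙ ℂ W)) : ℕ → W → Submodule ℂ W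
  | 0, p => span ℂ {p}
  | k + 1, p => osc Z k p ⊔ span ℂ {w | ∃ v : Fin (k + 1) → W → W,
      (∀ i, IsTangentField (affineCone Z) p (v i)) ∧ iterDeriv (k + 1) v p = w}

/-- The domain `Dom(FF^k_Z)` of the `k`-th fundamental form: `z` lies in it if for all `j < k` the
spaces `T̂^{(j)} Z` have constant rank near `z`, i.e. form a vector bundle there. -/
def domFF (k : ℕ) (Z : Set (ℙ ℂ W)) : Set (ℙ ℂ W) :=
  {z | z ∈ Z ∧ ∀ j < k, ∀ p ∈ z.submodule, p ≠ 0 →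
    ∀ᶠ q in 𝓝[affineCone Z] p, finrank ℂ (osc Z j q) = finrank ℂ (osc Z j p)}

/-- The tangent space `T_z Z = Hom(ẑ, T̂_z Z / ẑ)` as a subspace of `T_z ℙ W`. -/
abbrev tangentSpace (Z : Set (ℙ ℂ W)) (z : ℙ ℂ W) : Submodule ℂ (TP z) :=
  homTo z (tangentSpan (affineCone Z) z.rep)

/-- The osculating space `T^{(k)}_z Z = Hom(ẑ, T̂^{(k)}_z Z / ẑ)` as a subspace of `T_z ℙ W`. -/
abbrev oscSpace (k : ℕ) (Z : Set (ℙ ℂ W)) (z : ℙ ℂ W) : Submodule ℂ (TP z) :=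
  homTo z (osc Z k z.rep)

/-- The defining property of `FF^k_{z,Z} : Sym^k (T_z Z) → T_z ℙ W / T^{(k-1)}_z Z`. For `p ≠ 0`
in `ẑ`, the differential at `p` of `W ∖ 0 → ℙ W` sends a vector `w` to the element `θ` of
`T_z ℙ W = Hom(ẑ, W / ẑ)` with `θ p = w mod ẑ`. If `v_1, …, v_k` are fields tangent to `Ẑ` near `p`
whose values at `p` are sent to `u_1, …, u_k` by this differential and if `θ` is the image of
`v_k (v_{k-1} ⋯ v_2 (v_1))`, then `B (u_1, …, u_k)` is the class of `θ`. -/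
structure IsFundamentalForm (k : ℕ) (Z : Set (ℙ ℂ W)) (z : ℙ ℂ W)
    (B : MultilinearMap ℂ (fun _ : Fin k => tangentSpace Z z) (TP z ⧸ oscSpace (k - 1) Z z)) :
    Prop where
  symm : ∀ (σ : Equiv.Perm (Fin k)) (u : Fin k → tangentSpace Z z), B (u ∘ σ) = B u
  eq : ∀ p : z.submodule, p ≠ 0 → ∀ v : Fin k → W → W,
    (∀ i, IsTangentField (affineCone Z) p (v i)) →
    ∀ u : Fin k → tangentSpace Z z, (∀ i, (u i : TP z) p = z.submodule.mkQ (v i p)) →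
    ∀ θ : TP z, θ p = z.submodule.mkQ (iterDeriv k v p) → B u = (oscSpace (k - 1) Z z).mkQ θ

open Classical in
/-- The `k`-th fundamental form `FF^k_{z,Z} : Sym^k (T_z Z) → T_z ℙ W / T^{(k-1)}_z Z`, for `k ≥ 2`,
as a symmetric multilinear map: the unique one with the defining property. (It is `0` by convention
where this property does not determine a map.) -/
def fundamentalForm (k : ℕ) (Z : Set (ℙ ℂ W)) (z : ℙ ℂ W) :
    MultilinearMap ℂ (fun _ : Fin k => tangentSpace Z z) (TP z ⧸ oscSpace (k - 1) Z z) :=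
  if h : ∃! B, IsFundamentalForm k Z z B then h.choose else 0

/-- `Z` is linearly nondegenerate in `ℙ W`, also locally at `z`: no neighborhood of `z` in `Z` lies
in a hyperplane. -/
def IsLinearlyNondegenerateAt (Z : Set (ℙ ℂ W)) (z : ℙ ℂ W) : Prop :=
  ∀ p ∈ z.submodule, p ≠ 0 → ∀ N ∈ 𝓝 p, span ℂ (affineCone Z ∩ N) = ⊤

end FundamentalForms

/-! ### Hypersurfaces, lines on them, and the VMRT

Below, `f` is a homogeneous polynomial, and `X = Z(f)` is the hypersurface which it defines in the
projective space `ℙ (ℂ^n)`. -/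

section Hypersurfaces

variable {n : ℕ}

/-- The set of points of the hypersurface `X = Z(f)`. -/
def hypersurface (f : MvPolynomial (Fin n) ℂ) : Set (ℙ ℂ (Fin n → ℂ)) :=
  {x | ∀ p ∈ x.submodule, MvPolynomial.eval p f = 0}

/-- `X = Z(f)` is smooth at `x`, by the Jacobian criterion. -/
def IsSmoothPoint (f : MvPolynomial (Fin n) ℂ) (x : ℙ ℂ (Fin n → ℂ)) : Prop :=
  x ∈ hypersurface f ∧ ∀ p ∈ x.submodule, p ≠ 0 →
    ∃ i, MvPolynomial.eval p (MvPolynomial.pderiv i f) ≠ 0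

/-- The affine tangent space `T̂_x X = ker d_p f`, for `p` in `x̂`, of the hypersurface `X = Z(f)`. -/
def affineTangent (f : MvPolynomial (Fin n) ℂ) (x : ℙ ℂ (Fin n → ℂ)) :
    Submodule ℂ (Fin n → ℂ) where
  carrier := {v | ∀ p ∈ x.submodule, ∑ i, MvPolynomial.eval p (MvPolynomial.pderiv i f) * v i = 0}
  add_mem' ha hb p hp := by
    simp only [Pi.add_apply, mul_add, Finset.sum_add_distrib, ha p hp, hb p hp, add_zero]
  zero_mem' _ _ := by simp
  smul_mem' c v hv p hp := by
    have := hv p hp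
    simp only [Pi.smul_apply, smul_eq_mul, mul_left_comm _ c, ← Finset.mul_sum, this, mul_zero]

/-- The tangent space `T_x X = Hom(x̂, T̂_x X / x̂)` as a subspace of `T_x ℙ^{n-1}`. -/
abbrev TX (f : MvPolynomial (Fin n) ℂ) (x : ℙ ℂ (Fin n → ℂ)) : Submodule ℂ (TP x) :=
  homTo x (affineTangent f x)

theorem derivative_aeval (f : MvPolynomial (Fin n) ℂ) (g : Fin n → Polynomial ℂ) :
    Polynomial.derivative (MvPolynomial.aeval g f) =
      ∑ i, MvPolynomial.aeval g (MvPolynomial.pderiv i f) * Polynomial.derivative (g i) := by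
  induction f using MvPolynomial.induction_on with
  | C a => simp
  | add p q hp hq => simp [hp, hq, add_mul, Finset.sum_add_distrib]
  | mul_X p j hp =>
    simp only [map_mul, MvPolynomial.aeval_X, Polynomial.derivative_mul, hp,
      MvPolynomial.pderiv_mul, map_add, add_mul, Finset.sum_add_distrib, MvPolynomial.pderiv_X]
    congr 1
    · rw [Finset.sum_mul]
      exact Finset.sum_congr rfl fun i _ => by ring
    · rw [Finset.sum_eq_single j]
      · simp
      · intro i _ hi
        simp [hi.symm]
      · simp

theorem le_affineTangent (f : MvPolynomial (Fin n) ℂ) (x : ℙ ℂ (Fin n → ℂ))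
    (L : Submodule ℂ (Fin n → ℂ)) (hx : x.submodule ≤ L)
    (hL : ∀ p ∈ L, MvPolynomial.eval p f = 0) : L ≤ affineTangent f x := by
  intro v hv p hp
  let g : Fin n → Polynomial ℂ := fun i => Polynomial.C (p i) + Polynomial.X * Polynomial.C (v i)
  have key : ∀ (t : ℂ) (h : MvPolynomial (Fin n) ℂ),
      Polynomial.eval t (MvPolynomial.aeval g h) = MvPolynomial.eval (p + t • v) h := by
    intro t h
    induction h using MvPolynomial.induction_on with
    | C a => simp
    | add p q hp hq => simp [hp, hq]
    | mul_X p j hp =>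
      rw [map_mul, map_mul, Polynomial.eval_mul, hp, MvPolynomial.aeval_X, MvPolynomial.eval_X]
      simp only [g, Polynomial.eval_add, Polynomial.eval_mul, Polynomial.eval_C,
        Polynomial.eval_X, Pi.add_apply, Pi.smul_apply, smul_eq_mul]
  have h0 : MvPolynomial.aeval g f = 0 := by
    refine Polynomial.funext fun t => ?_
    rw [key, hL _ (add_mem (hx hp) (smul_mem _ t hv)), Polynomial.eval_zero]
  have h1 := derivative_aeval f g
  rw [h0, Polynomial.derivative_zero] at h1
  have h2 := congrArg (Polynomial.eval 0) h1
  simp only [Polynomial.eval_zero, Polynomial.eval_finsetSum, Polynomial.eval_mul, key] at h2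
  simpa [g] using h2.symm

theorem homTo_mono {V : Type*} [NormedAddCommGroup V] [NormedSpace ℂ V] (x : ℙ ℂ V)
    {S T : Submodule ℂ V} (h : S ≤ T) : homTo x S ≤ homTo x T :=
  fun _ hθ p => Submodule.map_mono h (hθ p)

/-- `ℙ L` is a projective line which passes through `x` and lies on `X = Z(f)`. -/
structure IsLineThrough (f : MvPolynomial (Fin n) ℂ) (x : ℙ ℂ (Fin n → ℂ))
    (L : Submodule ℂ (Fin n → ℂ)) : Prop where
  finrank_eq : finrank ℂ L = 2
  mem : x.submodule ≤ L
  subset : ∀ p ∈ L, MvPolynomial.eval p f = 0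

/-- The tangent direction `ℙ T_x (ℙ L)`, a point of `ℙ T_x X`, of a line `ℙ L` on `X` through `x`.
This is the identification of lines through `x` with points of the projectivized tangent space. -/
def lineDirection {f : MvPolynomial (Fin n) ℂ} {x : ℙ ℂ (Fin n → ℂ)}
    {L : Submodule ℂ (Fin n → ℂ)} (h : IsLineThrough f x L) : ℙ ℂ (TX f x) :=
  Projectivization.mk'' ((homTo x L).submoduleOf (TX f x)) <| by
    rw [(submoduleOfEquivOfLe (homTo_mono x (le_affineTangent f x L h.mem h.subset))).finrank_eq,
      finrank_homTo x L h.finrank_eq h.mem]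

/-- The VMRT `𝒞_x ⊆ ℙ T_x X`: the set of tangent directions at `x` of the lines on `X = Z(f)` that
pass through `x`. -/
def vmrt (f : MvPolynomial (Fin n) ℂ) (x : ℙ ℂ (Fin n → ℂ)) : Set (ℙ ℂ (TX f x)) :=
  {z | ∃ (L : Submodule ℂ (Fin n → ℂ)) (h : IsLineThrough f x L), lineDirection h = z}

end Hypersurfaces

/-! ### Normal bundles of lines on hypersurfaces

A holomorphic vector bundle on a set `Y` of points is described by its fibers `E y` and by the
predicate which says whether a section is holomorphic at (i.e. near) a given point. -/

section NormalBundle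

/-- Two holomorphic vector bundles are isomorphic: there are linear isomorphisms of the fibers under
which holomorphic sections correspond to each other. -/
def BundlesIsomorphic {Y : Type*} (E F : Y → Type*) [∀ y, AddCommGroup (E y)]
    [∀ y, Module ℂ (E y)] [∀ y, AddCommGroup (F y)] [∀ y, Module ℂ (F y)]
    (holE : (∀ y, E y) → Y → Prop) (holF : (∀ y, F y) → Y → Prop) : Prop :=
  ∃ φ : ∀ y, E y ≃ₗ[ℂ] F y, ∀ (σ : ∀ y, E y) (y : Y), holE σ y ↔ holF (fun y' => φ y' (σ y')) y

variable {n : ℕ}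

/-- The points of the projective line `ℙ L`. -/
def linePoints (L : Submodule ℂ (Fin n → ℂ)) : Set (ℙ ℂ (Fin n → ℂ)) := {x | x.submodule ≤ L}

/-- The fiber `T_x X / T_x ℓ` at `x` of the normal bundle of the line `ℓ = ℙ L` in `X = Z(f)`. -/
abbrev NormalFiber (f : MvPolynomial (Fin n) ℂ) (L : Submodule ℂ (Fin n → ℂ))
    (x : linePoints L) : Type :=
  TX f x.1 ⧸ (homTo x.1 L).submoduleOf (TX f x.1)

/-- A section `σ` of the normal bundle of `ℓ = ℙ L` in `X` is holomorphic near `x`: it is locally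
induced by a holomorphic map `v` that assigns to `p` in (an open subset of) the cone over `ℓ` a
vector in `T̂_{[p]} X`. The element of `T_{[p]} X` given by the vector `v p` is the `θ` with
`θ p = v p mod ℂ p`. -/
def normalHolAt (f : MvPolynomial (Fin n) ℂ) (L : Submodule ℂ (Fin n → ℂ))
    (σ : ∀ x : linePoints L, NormalFiber f L x) (x : linePoints L) : Prop :=
  ∃ p₀ ∈ x.1.submodule, p₀ ≠ 0 ∧ ∃ v : (Fin n → ℂ) → (Fin n → ℂ), AnalyticAt ℂ v p₀ ∧
    ∀ᶠ p in 𝓝 p₀, ∀ (y : linePoints L) (hp : p ∈ y.1.submodule),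
      ∃ θ : TX f y.1, (θ : TP y.1) ⟨p, hp⟩ = y.1.submodule.mkQ (v p) ∧
        σ y = ((homTo y.1 L).submoduleOf (TX f y.1)).mkQ θ

/-- The fiber at `x` of the bundle `𝒪(1)^a ⊕ 𝒪^b` on the line `ℙ L`. The fiber of `𝒪(1)` is the dual
of the tautological line `x̂`. -/
abbrev SplitFiber (a b : ℕ) (L : Submodule ℂ (Fin n → ℂ)) (x : linePoints L) : Type :=
  (Fin a → Module.Dual ℂ x.1.submodule) × (Fin b → ℂ)

/-- A section of `𝒪(1)^a ⊕ 𝒪^b` is holomorphic near `x`: in the coordinates given by evaluating at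
the points `p` of the cone over `ℙ L`, it is given by holomorphic functions. -/
def splitHolAt (a b : ℕ) (L : Submodule ℂ (Fin n → ℂ))
    (σ : ∀ x : linePoints L, SplitFiber a b L x) (x : linePoints L) : Prop :=
  ∃ p₀ ∈ x.1.submodule, p₀ ≠ 0 ∧ ∃ (g : (Fin n → ℂ) → Fin a → ℂ) (h : (Fin n → ℂ) → Fin b → ℂ),
    AnalyticAt ℂ g p₀ ∧ AnalyticAt ℂ h p₀ ∧
    ∀ᶠ p in 𝓝 p₀, ∀ (y : linePoints L) (hp : p ∈ y.1.submodule),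
      (∀ i, (σ y).1 i ⟨p, hp⟩ = g p i) ∧ (σ y).2 = h p

/-- The normal bundle of the line `ℓ = ℙ L` in `X = Z(f)` is isomorphic to `𝒪(1)^a ⊕ 𝒪^b`. -/
def NormalBundleIso (f : MvPolynomial (Fin n) ℂ) (L : Submodule ℂ (Fin n → ℂ)) (a b : ℕ) : Prop :=
  BundlesIsomorphic (NormalFiber f L) (SplitFiber a b L) (normalHolAt f L) (splitHolAt a b L)

end NormalBundle

/-! ### The special quartic -/

section Quartic

open MvPolynomial in
/-- The special quartic form `f` in the homogeneous coordinates `x_0, …, x_6` of `ℙ^6`. -/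
def quartic : MvPolynomial (Fin 7) ℂ :=
  (X 2 ^ 4 + X 3 ^ 4 + X 4 ^ 4 + X 5 ^ 4 + X 6 ^ 4)
    + X 0 ^ 3 * X 2 + X 1 ^ 3 * X 3 + X 0 ^ 2 * X 1 * X 4 + X 0 * X 1 ^ 2 * X 5
    + X 0 ^ 2 * X 2 ^ 2 + X 1 ^ 2 * X 3 ^ 2
    + (X 0 ^ 2 + X 0 * X 1 + X 1 ^ 2) * X 6 ^ 2
    + X 0 * X 4 ^ 3 + X 1 * X 5 ^ 3 + (X 0 + X 1) * X 6 ^ 3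

/-- The involution `(0 1)(2 3)(4 5)` of the coordinates. -/
def coordInvolution : Equiv.Perm (Fin 7) := Equiv.swap 0 1 * Equiv.swap 2 3 * Equiv.swap 4 5

/-- The cone `{x_2 = ⋯ = x_6 = 0}` over the line `ℓ`. -/
def ellCone : Submodule ℂ (Fin 7 → ℂ) where
  carrier := {v | ∀ i : Fin 7, 2 ≤ i → v i = 0}
  add_mem' ha hb i hi := by simp [ha i hi, hb i hi]
  zero_mem' _ _ := rfl
  smul_mem' c v hv i hi := by simp [hv i hi]

/-- The line `ℓ = {x_2 = ⋯ = x_6 = 0}` in `ℙ^6`. -/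
abbrev ell : Set (ℙ ℂ (Fin 7 → ℂ)) := linePoints ellCone

theorem finrank_ellCone : finrank ℂ ellCone = 2 := by
  let e : ellCone ≃ₗ[ℂ] (Fin 2 → ℂ) :=
    { toFun := fun v => ![v.1 0, v.1 1]
      map_add' := fun v w => by ext i; fin_cases i <;> simp
      map_smul' := fun c v => by ext i; fin_cases i <;> simp
      invFun := fun w => ⟨![w 0, w 1, 0, 0, 0, 0, 0], fun i hi => by
        fin_cases i <;> first | rfl | exact absurd hi (by decide)⟩
      left_inv := fun v => by
        have h := v.2
        apply Subtype.ext
        ext i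
        fin_cases i
        · rfl
        · rfl
        all_goals exact (h _ (by decide)).symm
      right_inv := fun w => by ext i; fin_cases i <;> rfl }
  rw [e.finrank_eq]; simp

theorem eval_quartic_of_mem (p : Fin 7 → ℂ) (hp : p ∈ ellCone) :
    MvPolynomial.eval p quartic = 0 := by
  have h : ∀ i : Fin 7, 2 ≤ i → p i = 0 := hp
  simp [quartic, h 2 (by decide), h 3 (by decide), h 4 (by decide), h 5 (by decide),
    h 6 (by decide)]

theorem isLineThrough_ell {x : ℙ ℂ (Fin 7 → ℂ)} (hx : x ∈ ell) :
    IsLineThrough quartic x ellCone :=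
  ⟨finrank_ellCone, hx, eval_quartic_of_mem⟩

/-- The point `ℓ_x = ℙ T_x ℓ` of `𝒞_x ⊆ ℙ T_x X`. -/
def ellDirection (x : ell) : ℙ ℂ (TX quartic x.1) := lineDirection (isLineThrough_ell x.2)

theorem vecP_ne_zero : (![1, 1, 0, 0, 0, 0, 0] : Fin 7 → ℂ) ≠ 0 :=
  fun h => one_ne_zero (congrFun h 0)

/-- The point `P = [1 : 1 : 0 : ⋯ : 0]` of `ℓ`. -/
def pointP : ell := ⟨Projectivization.mk ℂ ![1, 1, 0, 0, 0, 0, 0] vecP_ne_zero, by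
  change (Projectivization.mk ℂ _ _).submodule ≤ ellCone
  rw [Projectivization.submodule_mk, span_singleton_le_iff_mem]
  intro i hi
  fin_cases i <;> first | rfl | exact absurd hi (by decide)⟩

end Quartic

end LinesOnHypersurfaces

end

open LinesOnHypersurfaces

/-! Along ℓ, at (X, Y, 0, …, 0), the differential of f has entries X³, Y³, X²Y, XY² in the
directions x_2, …, x_5 and 0 in the others. These monomials have no common zero, whence smoothness.
The normal bundle is 𝒪(1), from the free direction x_6, plus the kernel of the map 𝒪(1)^4 → 𝒪(4)
given by the four monomials. Their syzygies are generated by three linear ones, so this kernel is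
𝒪^3 (`normalBundleIso_ell`).

For the VMRT at x = [a:b], choose (c, d) with ad - bc = 1 and join (a, b, 0, …, 0) to (c, d, u, τ).
On this line let X, Y be the first two coordinates and r = -bX + aY, the linear form vanishing at x.
There f equals r times a binary cubic whose four coefficients are `lineEq`. Its linear part is u, so
by the inverse function theorem the lines near ℓ form a curve u = U(τ) (`exists_implicit`). The
x_6-terms of f dictate the expansion (`exists_jet`): the coefficients of τ² and τ³ in U are, up to
sign, those of the cubics r(X² + XY + Y²) and r²(X + Y). These are independent for every r ≠ 0,
because X + Y does not divide X² + XY + Y². At P the coefficient of τ⁴ is independent of them as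
well, and the derivatives of orders 0 to 4 span the five-dimensional T_P X.

It remains to read off fundamental forms. If the cone over a curve consists of the multiples of
γ(s), with γ normalized by a linear coordinate y = 1 and parametrized by another one t, then
iterated derivatives of k tangent fields equal a multiple of γ^(k) plus lower derivatives of γ
(`exists_iterDeriv_eq`). Hence the osculating spaces are spanned by derivatives of γ, and the k-th
form is nonzero as soon as γ^(k) is not in the span of the lower ones (`fundamentalForm_ne_zero`).
-/

namespace LinesOnHypersurfaces

open Module Submodule Filter

noncomputable section

/-! ### Osculating spaces of the cone over a curve -/

section ConeGraph

variable {W : Type*} [NormedAddCommGroup W] [NormedSpace ℂ W]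

/-- The osculating space of order `k` at `s` of the curve `γ`. -/
def jetSpan (γ : ℂ → W) (k : ℕ) (s : ℂ) : Submodule ℂ W :=
  span ℂ (Set.range fun j : Fin (k + 1) => iteratedDeriv j γ s)

theorem iteratedDeriv_mem_jetSpan (γ : ℂ → W) {j k : ℕ} (h : j ≤ k) (s : ℂ) :
    iteratedDeriv j γ s ∈ jetSpan γ k s :=
  subset_span ⟨⟨j, Nat.lt_succ_of_le h⟩, rfl⟩

theorem jetSpan_le {γ : ℂ → W} {k : ℕ} {s : ℂ} {S : Submodule ℂ W} :
    jetSpan γ k s ≤ S ↔ ∀ j ≤ k, iteratedDeriv j γ s ∈ S := by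
  rw [jetSpan, span_le, Set.range_subset_iff]
  exact ⟨fun h j hj => h ⟨j, Nat.lt_succ_of_le hj⟩, fun h j => h j (Nat.le_of_lt_succ j.2)⟩

theorem jetSpan_mono (γ : ℂ → W) {j k : ℕ} (h : j ≤ k) (s : ℂ) : jetSpan γ j s ≤ jetSpan γ k s :=
  jetSpan_le.2 fun _ hi => iteratedDeriv_mem_jetSpan γ (hi.trans h) s

theorem jetSpan_succ (γ : ℂ → W) (k : ℕ) (s : ℂ) :
    jetSpan γ (k + 1) s = jetSpan γ k s ⊔ span ℂ {iteratedDeriv (k + 1) γ s} := by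
  refine le_antisymm (jetSpan_le.2 fun j hj => ?_) (sup_le (jetSpan_mono γ k.le_succ s) ?_)
  · rcases hj.lt_or_eq with h | rfl
    · exact mem_sup_left (iteratedDeriv_mem_jetSpan γ (Nat.le_of_lt_succ h) s)
    · exact mem_sup_right (mem_span_singleton_self _)
  · rw [span_singleton_le_iff_mem]
    exact iteratedDeriv_mem_jetSpan γ le_rfl s

theorem jetSpan_zero (γ : ℂ → W) (s : ℂ) : jetSpan γ 0 s = span ℂ {γ s} := by
  refine le_antisymm (jetSpan_le.2 fun j hj => ?_) ?_
  · obtain rfl : j = 0 := by omega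
    rw [iteratedDeriv_zero]
    exact mem_span_singleton_self _
  · rw [span_singleton_le_iff_mem]
    simpa using iteratedDeriv_mem_jetSpan γ (le_refl 0) s

/-- Near `p`, the set `A` is the cone over the curve `γ`, which is a graph over the coordinates
`y = 1` and `t`. -/
structure IsConeGraphAt (A : Set W) (y t : W →L[ℂ] ℂ) (γ : ℂ → W) (p : W) : Prop where
  ne : y p ≠ 0
  analyticAt : AnalyticAt ℂ γ (t p / y p)
  y_eq : ∀ᶠ s in 𝓝 (t p / y p), y (γ s) = 1
  t_eq : ∀ᶠ s in 𝓝 (t p / y p), t (γ s) = s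
  mem_iff : ∀ᶠ q in 𝓝 p, q ∈ A ↔ q = y q • γ (t q / y q)
  mem : p ∈ A

theorem analyticAt_iteratedDeriv [CompleteSpace W] {γ : ℂ → W} {s : ℂ} (h : AnalyticAt ℂ γ s)
    (j : ℕ) : AnalyticAt ℂ (iteratedDeriv j γ) s := by
  rw [iteratedDeriv_eq_iterate]
  exact h.iterated_deriv j

theorem analyticAt_clm_apply {E F G : Type*} [NormedAddCommGroup E] [NormedSpace ℂ E]
    [NormedAddCommGroup F] [NormedSpace ℂ F] [NormedAddCommGroup G] [NormedSpace ℂ G]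
    {L : E → F →L[ℂ] G} {v : E → F} {p : E} (hL : AnalyticAt ℂ L p) (hv : AnalyticAt ℂ v p) :
    AnalyticAt ℂ (fun q => L q (v q)) p :=
  AnalyticAt.fun_comp (g := fun u : (F →L[ℂ] G) × F => u.1 u.2) (f := fun q => (L q, v q))
    ((ContinuousLinearMap.id ℂ (F →L[ℂ] G)).analyticAt_bilinear (L p, v p)) (hL.prod hv)

/-- By the chain rule along curves in `A`, whose velocities span the tangent space. Thus a formula
valid only on the cone may be differentiated in tangent directions. -/
theorem fderiv_eq_of_eventuallyEq {A : Set W} {q w : W} {F G : W → W}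
    (hF : DifferentiableAt ℂ F q) (hG : DifferentiableAt ℂ G q) (h : ∀ᶠ x in 𝓝[A] q, F x = G x)
    (hw : w ∈ tangentSpan A q) : fderiv ℂ F q w = fderiv ℂ G q w := by
  have : tangentSpan A q ≤ LinearMap.ker (fderiv ℂ F q - fderiv ℂ G q).toLinearMap := by
    refine span_le.2 ?_
    rintro _ ⟨c, hc, rfl, hcA, rfl⟩
    have hd := hc.differentiableAt.hasDerivAt
    have hev : ∀ᶠ s in 𝓝 (0 : ℂ), F (c s) = G (c s) :=
      (tendsto_nhdsWithin_iff.2 ⟨hc.continuousAt, hcA⟩).eventually h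
    have h1 := (hF.hasFDerivAt.comp_hasDerivAt 0 hd)
    have h2 := (hG.hasFDerivAt.comp_hasDerivAt 0 hd)
    have h3 := h1.unique (h2.congr_of_eventuallyEq hev)
    simpa [sub_eq_zero] using h3
  simpa [sub_eq_zero] using this hw

namespace IsConeGraphAt

variable {A : Set W} {y t : W →L[ℂ] ℂ} {γ : ℂ → W} {p : W}

theorem eq (h : IsConeGraphAt A y t γ p) : p = y p • γ (t p / y p) :=
  h.mem_iff.self_of_nhds.1 h.mem

theorem analyticAt_div (h : IsConeGraphAt A y t γ p) :
    AnalyticAt ℂ (fun q => t q / y q) p :=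
  (t.analyticAt p).div (y.analyticAt p) h.ne

theorem tendsto_div (h : IsConeGraphAt A y t γ p) :
    Tendsto (fun q => t q / y q) (𝓝 p) (𝓝 (t p / y p)) :=
  h.analyticAt_div.continuousAt

theorem eventually [CompleteSpace W] (h : IsConeGraphAt A y t γ p) :
    ∀ᶠ q in 𝓝[A] p, IsConeGraphAt A y t γ q := by
  rw [eventually_nhdsWithin_iff]
  filter_upwards [h.mem_iff.eventually_nhds, y.continuous.continuousAt.eventually_ne h.ne,
    h.tendsto_div.eventually h.analyticAt.eventually_analyticAt,
    h.tendsto_div.eventually h.y_eq.eventually_nhds,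
    h.tendsto_div.eventually h.t_eq.eventually_nhds] with q h1 h2 h3 h4 h5 h6
  exact ⟨h2, h3, h4, h5, h1, h6⟩

theorem deriv_y (h : IsConeGraphAt A y t γ p) : y (deriv γ (t p / y p)) = 0 := by
  have h1 := y.hasFDerivAt.comp_hasDerivAt _ h.analyticAt.differentiableAt.hasDerivAt
  exact h1.unique ((hasDerivAt_const _ (1 : ℂ)).congr_of_eventuallyEq h.y_eq)

theorem deriv_t (h : IsConeGraphAt A y t γ p) : t (deriv γ (t p / y p)) = 1 := by
  have h1 := t.hasFDerivAt.comp_hasDerivAt _ h.analyticAt.differentiableAt.hasDerivAt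
  exact h1.unique ((hasDerivAt_id _).congr_of_eventuallyEq h.t_eq)

theorem eventually_mem (h : IsConeGraphAt A y t γ p) :
    ∀ᶠ u in 𝓝 ((y p, t p / y p) : ℂ × ℂ), u.1 • γ u.2 ∈ A := by
  have hc : ContinuousAt (fun u : ℂ × ℂ => u.1 • γ u.2) (y p, t p / y p) :=
    continuousAt_fst.smul (ContinuousAt.comp (f := Prod.snd) (x := (y p, t p / y p))
      h.analyticAt.continuousAt continuousAt_snd)
  have h0 : Tendsto (fun u : ℂ × ℂ => u.1 • γ u.2) (𝓝 (y p, t p / y p)) (𝓝 p) := by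
    have := hc.tendsto
    rwa [← h.eq] at this
  filter_upwards [h0.eventually h.mem_iff, continuousAt_snd.eventually h.y_eq,
    continuousAt_snd.eventually h.t_eq, continuousAt_fst.eventually_ne h.ne] with u h1 h2 h3 h4
  rw [h1]
  simp only [map_smul, h2, h3, smul_eq_mul, mul_one]
  rw [mul_div_cancel_left₀ _ h4]

/-- A curve in the cone has the form y(c) γ(t(c)/y(c)), and its velocity is a combination of γ and
γ'. Conversely, varying only the scale gives γ, and varying only the parameter gives a nonzero
multiple of γ'. -/
theorem tangentSpan_eq (h : IsConeGraphAt A y t γ p) :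
    tangentSpan A p = jetSpan γ 1 (t p / y p) := by
  apply le_antisymm
  · refine span_le.2 ?_
    rintro _ ⟨c, hc, rfl, hcA, rfl⟩
    have hd := hc.differentiableAt.hasDerivAt
    have hy := y.hasFDerivAt.comp_hasDerivAt 0 hd
    have ht := t.hasFDerivAt.comp_hasDerivAt 0 hd
    have hq := ht.div hy h.ne
    have hg : HasDerivAt (γ ∘ fun s => (t ∘ c) s / (y ∘ c) s) _ (0 : ℂ) :=
      HasDerivAt.scomp (0 : ℂ) h.analyticAt.differentiableAt.hasDerivAt hq
    have hs := hy.smul hg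
    have hev : c =ᶠ[𝓝 0] (y ∘ c) • (γ ∘ fun s => (t ∘ c) s / (y ∘ c) s) := by
      filter_upwards [hcA, hc.continuousAt.eventually h.mem_iff] with s h1 h2
      exact h2.1 h1
    rw [SetLike.mem_coe, hd.unique (hs.congr_of_eventuallyEq hev)]
    refine add_mem (smul_mem _ _ (smul_mem _ _ ?_)) (smul_mem _ _ ?_)
    · simpa using iteratedDeriv_mem_jetSpan γ (le_refl 1) _
    · simpa using iteratedDeriv_mem_jetSpan γ (zero_le_one) (t (c 0) / y (c 0))
  · have hcont : ∀ u v : ℂ, Tendsto (fun s : ℂ => ((y p + s * u, t p / y p + s * v) : ℂ × ℂ))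
        (𝓝 0) (𝓝 (y p, t p / y p)) := fun u v => by
      have : ContinuousAt (fun s : ℂ => ((y p + s * u, t p / y p + s * v) : ℂ × ℂ)) 0 := by
        fun_prop
      simpa [ContinuousAt] using this
    rw [jetSpan_le]
    intro j hj
    interval_cases j
    · rw [iteratedDeriv_zero]
      refine subset_span ⟨fun s => (y p + s * 1) • γ (t p / y p + s * 0), ?_, ?_,
        (hcont 1 0).eventually h.eventually_mem, ?_⟩
      · simp only [mul_zero, add_zero]
        fun_prop
      · simp [← h.eq]
      · have : HasDerivAt (fun s : ℂ => (y p + s) • γ (t p / y p)) _ 0 :=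
          ((hasDerivAt_id (0 : ℂ)).const_add (y p)).smul_const _
        simpa using this.deriv
    · rw [iteratedDeriv_one]
      have key : y p • deriv γ (t p / y p) ∈ tangentSpan A p := by
        refine subset_span ⟨fun s => (y p + s * 0) • γ (t p / y p + s * 1), ?_, ?_,
          (hcont 0 1).eventually h.eventually_mem, ?_⟩
        · simp only [mul_zero, add_zero, mul_one]
          refine analyticAt_const.smul (AnalyticAt.fun_comp (g := γ) ?_ (by fun_prop))
          simpa using h.analyticAt
        · simp [← h.eq]
        · have h1 : HasDerivAt γ (deriv γ (t p / y p)) (t p / y p + 0) := by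
            simpa using h.analyticAt.differentiableAt.hasDerivAt
          have : HasDerivAt (fun s => y p • γ (t p / y p + s)) _ 0 :=
            (h1.scomp 0 ((hasDerivAt_id (0 : ℂ)).const_add (t p / y p))).const_smul (y p)
          simpa using this.deriv
      have := smul_mem _ (y p)⁻¹ key
      rwa [smul_smul, inv_mul_cancel₀ h.ne, one_smul] at this

/-- On the cone, a tangent vector is a combination of the vectors `γ` and `γ'`; this is the
coefficient of the latter. -/
theorem eq_of_mem_tangentSpan (h : IsConeGraphAt A y t γ p) {w : W} (hw : w ∈ tangentSpan A p) :
    w = y w • γ (t p / y p) + (t w - t p / y p * y w) • deriv γ (t p / y p) := by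
  have hy := h.y_eq.self_of_nhds
  have ht := h.t_eq.self_of_nhds
  have hy' := h.deriv_y
  have ht' := h.deriv_t
  rw [h.tangentSpan_eq] at hw
  generalize t p / y p = s at *
  have h2 : jetSpan γ 1 s = span ℂ {γ s, deriv γ s} := by
    rw [jetSpan_succ, jetSpan_zero, ← span_union, Set.singleton_union]; simp
  rw [h2, mem_span_pair] at hw
  obtain ⟨a, b, rfl⟩ := hw
  simp [hy, ht, hy', ht', mul_comm s]

variable [CompleteSpace W]

theorem analyticAt_iterDeriv {k : ℕ} {v : Fin k → W → W} {p : W} (hv : ∀ i, AnalyticAt ℂ (v i) p) :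
    AnalyticAt ℂ (iterDeriv k v) p := by
  induction k with
  | zero => exact analyticAt_id
  | succ k ih => exact analyticAt_clm_apply (ih fun i => hv i.castSucc).fderiv (hv _)

/-- Induction on the number of fields, starting from q = y(q) γ(t/y). A tangent field w moves the
parameter t/y at speed β = (t(w) - (t/y) y(w))/y, so the product rule turns c_j γ^(j) into w(c_j)
γ^(j) + c_j β γ^(j+1). The top coefficient picks up one factor β per field. -/
theorem exists_iterDeriv_eq (h : IsConeGraphAt A y t γ p) {k : ℕ} (v : Fin k → W → W)
    (hv : ∀ i, IsTangentField A p (v i)) :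
    ∃ c : ℕ → W → ℂ, (∀ j, AnalyticAt ℂ (c j) p) ∧
      (∀ᶠ q in 𝓝[A] p, iterDeriv k v q =
        ∑ j ∈ Finset.range (k + 1), c j q • iteratedDeriv j γ (t q / y q)) ∧
      c k p = y p * ∏ i, ((t (v i p) - t p / y p * y (v i p)) / y p) := by
  induction k with
  | zero =>
    refine ⟨fun _ q => y q, fun _ => y.analyticAt p, ?_, by simp⟩
    filter_upwards [h.eventually] with q hq
    simpa [iterDeriv] using hq.eq
  | succ k ih =>
    obtain ⟨c, hc, hceq, hcp⟩ := ih (fun i => v i.castSucc) fun i => hv _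
    set w := v (Fin.last k) with hw
    set β : W → ℂ := fun q => (t (w q) - t q / y q * y (w q)) / y q with hβ
    have hwan : AnalyticAt ℂ w p := (hv (Fin.last k)).1
    have hβan : AnalyticAt ℂ β p := by
      refine AnalyticAt.div (AnalyticAt.sub ?_ (h.analyticAt_div.mul ?_)) (y.analyticAt p) h.ne
      · exact (t.analyticAt _).comp hwan
      · exact (y.analyticAt _).comp hwan
    -- The first summand comes from differentiating the coefficient, the second from differentiating
    -- γ^(j-1). The guard `j ≤ k` discards `c (k + 1)`, which does not occur in the previous
    -- expansion.
    refine ⟨fun j q => (if j ≤ k then fderiv ℂ (c j) q (w q) else 0) +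
      (if j = 0 then 0 else c (j - 1) q * β q), fun j => ?_, ?_, ?_⟩
    · refine AnalyticAt.add ?_ ?_
      · split_ifs
        · exact analyticAt_clm_apply (hc j).fderiv hwan
        · exact analyticAt_const
      · split_ifs
        · exact analyticAt_const
        · exact (hc _).mul hβan
    · have hcan : ∀ᶠ q in 𝓝 p, ∀ j ∈ Finset.range (k + 1), AnalyticAt ℂ (c j) q := by
        rw [eventually_all_finset]
        exact fun j _ => (hc j).eventually_analyticAt
      filter_upwards [h.eventually, eventually_eventually_nhdsWithin.2 hceq, (hv (Fin.last k)).2,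
        mem_nhdsWithin_of_mem_nhds hcan,
        mem_nhdsWithin_of_mem_nhds (analyticAt_iterDeriv fun i => (hv (Fin.castSucc i)).1
          ).eventually_analyticAt] with q hq h1 h2 h3 h4
      have hds := hq.analyticAt_div.differentiableAt.hasFDerivAt
      set D := fderiv ℂ (fun q => t q / y q) q
      have hdsw : D (w q) = β q := by
        have hl : HasDerivAt (fun ε : ℂ => q + ε • w q) (w q) 0 := by
          simpa using ((hasDerivAt_id (0 : ℂ)).smul_const (w q)).const_add q
        have h0 : q = q + (0 : ℂ) • w q := by simp
        have h5 : HasDerivAt (fun ε : ℂ => t (q + ε • w q) / y (q + ε • w q)) (D (w q)) 0 :=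
          HasFDerivAt.comp_hasDerivAt_of_eq (0 : ℂ) hds hl h0
        have h6 : HasDerivAt (fun ε : ℂ => t (q + ε • w q) / y (q + ε • w q)) _ 0 :=
          HasDerivAt.fun_div (t.hasFDerivAt.comp_hasDerivAt (0 : ℂ) hl)
            (y.hasFDerivAt.comp_hasDerivAt (0 : ℂ) hl) (by simpa using hq.ne)
        rw [h5.unique h6]
        have := hq.ne
        simp [hβ]
        field_simp
      have hdsw' : D (v (Fin.last k) q) = β q := hdsw
      have hterm : ∀ j ∈ Finset.range (k + 1), HasFDerivAt
          (fun q => c j q • iteratedDeriv j γ (t q / y q))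
          (c j q • ((D.smulRight
              (iteratedDeriv (j + 1) γ (t q / y q))))
            + (fderiv ℂ (c j) q).smulRight (iteratedDeriv j γ (t q / y q))) q := by
        intro j hj
        refine (h3 j hj).differentiableAt.hasFDerivAt.fun_smul ?_
        have : HasDerivAt (iteratedDeriv j γ) (iteratedDeriv (j + 1) γ (t q / y q)) (t q / y q) := by
          rw [iteratedDeriv_succ]
          exact (analyticAt_iteratedDeriv hq.analyticAt j).differentiableAt.hasDerivAt
        simpa [Function.comp_def] using! this.hasFDerivAt.comp q hds
      have hsum := HasFDerivAt.fun_sum hterm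
      change fderiv ℂ (iterDeriv k fun i => v i.castSucc) q (w q) = _
      rw [fderiv_eq_of_eventuallyEq h4.differentiableAt hsum.differentiableAt h1 h2, hsum.fderiv]
      simp only [sum_apply, add_apply, smul_apply, ContinuousLinearMap.smulRight_apply, hdsw',
        add_smul, Finset.sum_add_distrib]
      rw [Finset.sum_range_succ (fun x => (if x ≤ k then _ else _) • _),
        Finset.sum_range_succ' (fun x => (if x = 0 then _ else _) • _), add_comm]
      congr 1
      · simp only [Nat.not_succ_le_self, if_false, zero_smul, add_zero]
        refine Finset.sum_congr rfl fun j hj => ?_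
        rw [if_pos (Nat.le_of_lt_succ (Finset.mem_range.1 hj))]
      · simp [smul_smul]
    · simp only [Nat.not_succ_le_self, if_false, zero_add, Nat.succ_ne_zero, Nat.add_sub_cancel,
        hcp, Fin.prod_univ_castSucc]
      simp only [hβ, mul_assoc, hw]

end IsConeGraphAt

namespace IsConeGraphAt

section

variable {A : Set W} {y t : W →L[ℂ] ℂ} {γ : ℂ → W} {p : W}

theorem isTangentField_coeff (h : IsConeGraphAt A y t γ p) (c : ℂ) :
    (t ((c * y p) • deriv γ (t p / y p)) - t p / y p * y ((c * y p) • deriv γ (t p / y p))) / y p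
      = c := by
  have := h.ne
  simp [h.deriv_t, h.deriv_y, this]

variable [CompleteSpace W]

/-- The top coefficient of an iterated derivative of tangent fields along the cone over `γ`. -/
theorem iterDeriv_sub_mem (h : IsConeGraphAt A y t γ p) {k : ℕ} (v : Fin (k + 1) → W → W)
    (hv : ∀ i, IsTangentField A p (v i)) :
    iterDeriv (k + 1) v p - (y p * ∏ i, ((t (v i p) - t p / y p * y (v i p)) / y p)) •
      iteratedDeriv (k + 1) γ (t p / y p) ∈ jetSpan γ k (t p / y p) := by
  obtain ⟨c, -, hc, hck⟩ := h.exists_iterDeriv_eq v hv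
  rw [hc.self_of_nhdsWithin h.mem, Finset.sum_range_succ, hck, add_sub_cancel_right]
  exact sum_mem fun j hj => smul_mem _ _
    (iteratedDeriv_mem_jetSpan γ (Nat.le_of_lt_succ (Finset.mem_range.1 hj)) _)

/-- The field `y γ'`, which is tangent to the cone over `γ`. -/
theorem isTangentField (h : IsConeGraphAt A y t γ p) (c : ℂ) :
    IsTangentField A p fun q => (c * y q) • deriv γ (t q / y q) := by
  constructor
  · refine (analyticAt_const.mul (y.analyticAt p)).smul ?_
    exact AnalyticAt.fun_comp (g := deriv γ) h.analyticAt.deriv h.analyticAt_div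
  · filter_upwards [h.eventually] with q hq
    rw [hq.tangentSpan_eq]
    refine smul_mem _ _ ?_
    simpa using iteratedDeriv_mem_jetSpan γ (le_refl 1) (t q / y q)

end

section

variable {Z : Set (ℙ ℂ W)} {y t : W →L[ℂ] ℂ} {γ : ℂ → W} {p : W} [CompleteSpace W]

/-- Iterated derivatives stay in the span of the jets by `iterDeriv_sub_mem`. For the other
inclusion all fields are taken to be y γ', which moves t/y at unit speed, so that the top
coefficient is y p ≠ 0. -/
theorem osc_eq (h : IsConeGraphAt (affineCone Z) y t γ p) (k : ℕ) :
    osc Z k p = jetSpan γ k (t p / y p) := by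
  induction k with
  | zero =>
    rw [osc, jetSpan_zero]
    conv_lhs => rw [h.eq]
    exact span_singleton_smul_eq h.ne.isUnit _
  | succ k ih =>
    rw [osc, ih]
    apply le_antisymm
    · refine sup_le (jetSpan_mono γ k.le_succ _) (span_le.2 ?_)
      rintro _ ⟨v, hv, rfl⟩
      have := jetSpan_mono γ k.le_succ _ (h.iterDeriv_sub_mem v hv)
      rwa [sub_mem_iff_left] at this
      exact smul_mem _ _ (iteratedDeriv_mem_jetSpan γ le_rfl _)
    · rw [jetSpan_succ]
      refine sup_le le_sup_left ?_
      rw [span_singleton_le_iff_mem]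
      let v : Fin (k + 1) → W → W := fun _ q => ((1 : ℂ) * y q) • deriv γ (t q / y q)
      have hv : ∀ i, IsTangentField (affineCone Z) p (v i) := fun _ => h.isTangentField 1
      have h1 := h.iterDeriv_sub_mem v hv
      have h2 : iterDeriv (k + 1) v p ∈ span ℂ {w | ∃ v : Fin (k + 1) → W → W,
          (∀ i, IsTangentField (affineCone Z) p (v i)) ∧ iterDeriv (k + 1) v p = w} :=
        subset_span ⟨v, hv, rfl⟩
      have h3 := sub_mem (mem_sup_right h2 : _ ∈ jetSpan γ k (t p / y p) ⊔ _) (mem_sup_left h1)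
      rw [sub_sub_cancel] at h3
      have h4 := smul_mem _ (y p)⁻¹ h3
      simp only [v, h.isTangentField_coeff, Finset.prod_const_one, mul_one, smul_smul,
        inv_mul_cancel₀ h.ne, one_smul] at h4
      exact h4

end

end IsConeGraphAt

/-! ### Fundamental forms, nondegeneracy and smoothness of a curve given by its cone -/

theorem exists_smul_of_mem_submodule {x : ℙ ℂ W} {p q : W} (hp : p ∈ x.submodule) (hp0 : p ≠ 0)
    (hq : q ∈ x.submodule) : ∃ c : ℂ, c • p = q := by
  obtain ⟨c, hc⟩ := (finrank_eq_one_iff_of_nonzero' (⟨p, hp⟩ : x.submodule)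
    (fun h => hp0 (congrArg Subtype.val h))).1 x.finrank_submodule ⟨q, hq⟩
  exact ⟨c, congrArg Subtype.val hc⟩

theorem mem_homTo_iff {x : ℙ ℂ W} {S : Submodule ℂ W} {p : W} (hp : p ∈ x.submodule) (hp0 : p ≠ 0)
    {θ : TP x} : θ ∈ homTo x S ↔ θ ⟨p, hp⟩ ∈ S.map x.submodule.mkQ := by
  refine ⟨fun h => h _, fun h => ?_⟩
  rintro ⟨q, hq⟩
  obtain ⟨c, rfl⟩ := exists_smul_of_mem_submodule hp hp0 hq
  have : θ (c • (⟨p, hp⟩ : x.submodule)) ∈ S.map x.submodule.mkQ := by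
    rw [map_smul]
    exact smul_mem _ _ h
  exact this

theorem TP.ext_of_ne_zero {x : ℙ ℂ W} {p : x.submodule} (hp0 : p ≠ 0)
    {θ η : TP x} (h : θ p = η p) : θ = η := by
  refine DFunLike.ext _ _ fun q => ?_
  obtain ⟨c, rfl⟩ := (finrank_eq_one_iff_of_nonzero' p hp0).1 x.finrank_submodule q
  rw [map_smul, map_smul, h]

theorem exists_apply_eq {x : ℙ ℂ W} {p : x.submodule} (hp0 : p ≠ 0) (w : W ⧸ x.submodule) :
    ∃ θ : TP x, θ p = w := by
  obtain ⟨f, hf⟩ := SeparatingDual.exists_eq_one (R := ℂ) hp0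
  refine ⟨f.smulRight w, ?_⟩
  change f p • w = w
  rw [hf, one_smul]

theorem exists_toTP {x : ℙ ℂ W} {e : x.submodule} (he : e ≠ 0) :
    ∃ Λ : W →ₗ[ℂ] TP x, ∀ v, Λ v e = x.submodule.mkQ v := by
  choose F hF using fun v => exists_apply_eq he (x.submodule.mkQ v)
  refine ⟨⟨⟨F, fun v w => TP.ext_of_ne_zero he ?_⟩, fun r v => TP.ext_of_ne_zero he ?_⟩, hF⟩
  · rw [hF, map_add, ← hF, ← hF]; rfl
  · rw [hF, map_smul, ← hF]; rfl

theorem smul_mem_affineCone {Z : Set (ℙ ℂ W)} {c : ℂ} (hc : c ≠ 0) {q : W} :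
    c • q ∈ affineCone Z ↔ q ∈ affineCone Z := by
  simp only [affineCone, Set.mem_ofPred_eq, smul_mem_iff _ hc]

/-- The cone over `Z` near the point `z` is the cone over the curve `γ`, which is a graph over
the coordinates `y = 1` and `t`, with `t = 0` at `z`. -/
structure IsConeGraph (Z : Set (ℙ ℂ W)) (z : ℙ ℂ W) (y t : W →L[ℂ] ℂ) (γ : ℂ → W) : Prop where
  mem : γ 0 ∈ z.submodule
  t_zero : t (γ 0) = 0
  isConeGraphAt : IsConeGraphAt (affineCone Z) y t γ (γ 0)

theorem IsConeGraphAt.smul {Z : Set (ℙ ℂ W)} {y t : W →L[ℂ] ℂ} {γ : ℂ → W} {p : W}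
    (h : IsConeGraphAt (affineCone Z) y t γ p) {c : ℂ} (hc : c ≠ 0) :
    IsConeGraphAt (affineCone Z) y t γ (c • p) := by
  have hdiv : ∀ (c : ℂ) (_ : c ≠ 0) (q : W), t (c • q) / y (c • q) = t q / y q := fun c hc q => by
    simp only [map_smul, smul_eq_mul, mul_div_mul_left _ _ hc]
  refine ⟨by simp [hc, h.ne], ?_, ?_, ?_, ?_, (smul_mem_affineCone hc).2 h.mem⟩
  · rw [hdiv c hc]; exact h.analyticAt
  · rw [hdiv c hc]; exact h.y_eq
  · rw [hdiv c hc]; exact h.t_eq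
  · have hcont : Tendsto (fun q : W => c⁻¹ • q) (𝓝 (c • p)) (𝓝 p) := by
      have : ContinuousAt (fun q : W => c⁻¹ • q) (c • p) := by fun_prop
      simpa [ContinuousAt, smul_smul, inv_mul_cancel₀ hc] using this
    filter_upwards [hcont.eventually h.mem_iff] with q hq
    rw [smul_mem_affineCone (inv_ne_zero hc), hdiv _ (inv_ne_zero hc)] at hq
    rw [hq, map_smul, smul_assoc]
    exact (smul_right_injective W (inv_ne_zero hc)).eq_iff

namespace IsConeGraph

variable {Z : Set (ℙ ℂ W)} {z : ℙ ℂ W} {y t : W →L[ℂ] ℂ} {γ : ℂ → W}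

theorem ne_zero (h : IsConeGraph Z z y t γ) : γ 0 ≠ 0 := fun h0 =>
  h.isConeGraphAt.ne (by rw [h0, map_zero])

theorem y_zero (h : IsConeGraph Z z y t γ) : y (γ 0) = 1 := by
  have := h.isConeGraphAt.y_eq.self_of_nhds
  rwa [h.t_zero, zero_div] at this

theorem t_eq_zero (h : IsConeGraph Z z y t γ) {p : W} (hp : p ∈ z.submodule) : t p = 0 := by
  obtain ⟨c, rfl⟩ := exists_smul_of_mem_submodule h.mem h.ne_zero hp
  rw [map_smul, h.t_zero, smul_zero]

theorem eq_smul (h : IsConeGraph Z z y t γ) {p : W} (hp : p ∈ z.submodule) : p = y p • γ 0 := by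
  obtain ⟨c, rfl⟩ := exists_smul_of_mem_submodule h.mem h.ne_zero hp
  rw [map_smul, h.y_zero, smul_eq_mul, mul_one]

theorem at_of_mem (h : IsConeGraph Z z y t γ) {p : W} (hp : p ∈ z.submodule) (hp0 : p ≠ 0) :
    IsConeGraphAt (affineCone Z) y t γ p := by
  obtain ⟨c, rfl⟩ := exists_smul_of_mem_submodule h.mem h.ne_zero hp
  exact h.isConeGraphAt.smul fun hc => hp0 (by rw [hc, zero_smul])

theorem t_div (h : IsConeGraph Z z y t γ) {p : W} (hp : p ∈ z.submodule) : t p / y p = 0 := by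
  rw [h.t_eq_zero hp, zero_div]

theorem mem_set (h : IsConeGraph Z z y t γ) : z ∈ Z := by
  obtain ⟨z', hz', hp⟩ := h.isConeGraphAt.mem
  have : z = z' := by
    apply Projectivization.submodule_injective
    ext p
    constructor
    · intro hq
      rw [h.eq_smul hq]
      exact smul_mem _ _ hp
    · intro hq
      obtain ⟨c, rfl⟩ := exists_smul_of_mem_submodule hp h.ne_zero hq
      exact smul_mem _ _ h.mem
  rwa [this]

theorem analyticAt (h : IsConeGraph Z z y t γ) : AnalyticAt ℂ γ 0 := by
  have := h.isConeGraphAt.analyticAt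
  rwa [h.t_div h.mem] at this

variable [CompleteSpace W]

/-- Linear independence of a finite tuple is an open condition, so for j < k the osculating space of
order j keeps rank j + 1 near z. -/
theorem mem_domFF (h : IsConeGraph Z z y t γ) {k : ℕ}
    (hli : LinearIndependent ℂ fun j : Fin k => iteratedDeriv j γ 0) : z ∈ domFF k Z := by
  refine ⟨h.mem_set, fun j hj p hp hp0 => ?_⟩
  have hp' := h.at_of_mem hp hp0
  have hs : Tendsto (fun q => t q / y q) (𝓝 p) (𝓝 0) := by
    have := hp'.tendsto_div
    rwa [h.t_div hp] at this
  have hli' : LinearIndependent ℂ fun i : Fin (j + 1) => iteratedDeriv i γ 0 :=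
    hli.comp (Fin.castLE hj) (Fin.castLE_injective _)
  have hc : ContinuousAt (fun s (i : Fin (j + 1)) => iteratedDeriv i γ s) 0 :=
    continuousAt_pi.2 fun i => (analyticAt_iteratedDeriv h.analyticAt i).continuousAt
  have hev : ∀ᶠ s in 𝓝 (0 : ℂ), LinearIndependent ℂ fun i : Fin (j + 1) => iteratedDeriv i γ s :=
    hc.eventually (isOpen_setOfPred_linearIndependent.mem_nhds hli')
  filter_upwards [hp'.eventually, mem_nhdsWithin_of_mem_nhds (hs.eventually hev)] with q h1 h2
  rw [h1.osc_eq, hp'.osc_eq, h.t_div hp, jetSpan, jetSpan, finrank_span_eq_card h2,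
    finrank_span_eq_card hli']

/-- The tangent line of the curve is spanned by the class of γ', and the form sends u to the product
of the coordinates of the u_i times the class of γ^(k+1). That class is nonzero by hypothesis. -/
theorem fundamentalForm_ne_zero (h : IsConeGraph Z z y t γ) {k : ℕ}
    (hk : iteratedDeriv (k + 1) γ 0 ∉ jetSpan γ k 0) : fundamentalForm (k + 1) Z z ≠ 0 := by
  let e : z.submodule := ⟨γ 0, h.mem⟩
  have he : e ≠ 0 := fun h0 => h.ne_zero (congrArg Subtype.val h0)
  let τ : (W ⧸ z.submodule) →ₗ[ℂ] ℂ := z.submodule.liftQ t.toLinearMap fun p hp => h.t_eq_zero hp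
  let coeff : tangentSpace Z z →ₗ[ℂ] ℂ :=
    { toFun := fun u => τ ((u : TP z) e)
      map_add' := fun u v => τ.map_add _ _
      map_smul' := fun c u => τ.map_smul _ _ }
  obtain ⟨Θ, hΘ⟩ := exists_apply_eq he (z.submodule.mkQ (iteratedDeriv (k + 1) γ 0))
  have hrepmem : z.rep ∈ z.submodule := z.submodule_eq ▸ mem_span_singleton_self z.rep
  have hosc : osc Z k z.rep = jetSpan γ k 0 := by
    rw [(h.at_of_mem hrepmem z.rep_nonzero).osc_eq, h.t_div hrepmem]
  have htan : tangentSpan (affineCone Z) z.rep = jetSpan γ 1 0 := by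
    rw [(h.at_of_mem hrepmem z.rep_nonzero).tangentSpan_eq, h.t_div hrepmem]
  have hΘmem : Θ ∉ oscSpace k Z z := by
    rw [oscSpace, mem_homTo_iff h.mem h.ne_zero]
    change Θ e ∉ _
    rw [hΘ, hosc]
    rintro ⟨w, hw, hwe⟩
    rw [eq_comm, ← sub_eq_zero, ← map_sub, mkQ_apply, Quotient.mk_eq_zero] at hwe
    refine hk ?_
    rw [← sub_add_cancel (iteratedDeriv (k + 1) γ 0) w]
    refine add_mem ?_ hw
    rw [h.eq_smul hwe]
    exact smul_mem _ _ (by simpa using iteratedDeriv_mem_jetSpan γ (Nat.zero_le k) 0)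
  -- At z the parameter is 0 and γ(0) dies in the quotient, so the coordinate t alone determines a
  -- tangent vector.
  have hu : ∀ u : tangentSpace Z z, (u : TP z) e = z.submodule.mkQ (coeff u • deriv γ 0) := by
    intro u
    have h1 := u.2 e
    rw [htan] at h1
    obtain ⟨w, hw, hwe⟩ := h1
    have h2 := h.isConeGraphAt.eq_of_mem_tangentSpan (w := w)
      (by rw [h.isConeGraphAt.tangentSpan_eq, h.t_div h.mem]; exact hw)
    rw [h.t_div h.mem, zero_mul, sub_zero] at h2
    have h3 : coeff u = t w := by
      change τ ((u : TP z) e) = _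
      rw [← hwe]
      rfl
    rw [h3, ← hwe, ← sub_eq_zero, ← map_sub, mkQ_apply, Quotient.mk_eq_zero]
    nth_rw 1 [h2]
    rw [add_sub_cancel_right]
    exact smul_mem _ _ h.mem
  let B : MultilinearMap ℂ (fun _ : Fin (k + 1) => tangentSpace Z z) (TP z ⧸ oscSpace k Z z) :=
    ((MultilinearMap.mkPiAlgebra ℂ (Fin (k + 1)) ℂ).compLinearMap fun _ => coeff).smulRight
      ((oscSpace k Z z).mkQ Θ)
  have hB : ∀ u, B u = (∏ i, coeff (u i)) • (oscSpace k Z z).mkQ Θ := fun u => rfl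
  -- The defining property at an arbitrary p = y(p) e. The speeds t(v_i)/y(p) are exactly the
  -- coordinates of the u_i, and the factor y(p) of the top coefficient is absorbed by Θ p = y(p) Θ
  -- e.
  have hval : ∀ (p : z.submodule), p ≠ 0 → ∀ v : Fin (k + 1) → W → W,
      (∀ i, IsTangentField (affineCone Z) p (v i)) →
      ∀ u : Fin (k + 1) → tangentSpace Z z,
      (∀ i, (u i : TP z) p = z.submodule.mkQ (v i p)) →
      ∀ θ : TP z, θ p = z.submodule.mkQ (iterDeriv (k + 1) v p) →
      (∏ i, coeff (u i)) • (oscSpace k Z z).mkQ Θ = (oscSpace k Z z).mkQ θ := by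
    intro p hp v hv u huv θ hθ
    have hp0 : (p : W) ≠ 0 := fun h0 => hp (Subtype.ext h0)
    have hat := h.at_of_mem p.2 hp0
    have hpe : p = y p • e := Subtype.ext (h.eq_smul p.2)
    have h1 := hat.iterDeriv_sub_mem v hv
    have hco : ∀ i, coeff (u i) = (t (v i p) - t p / y p * y (v i p)) / y p := by
      intro i
      rw [h.t_div p.2, zero_mul, sub_zero, eq_div_iff hat.ne, mul_comm, ← smul_eq_mul,
        ← map_smul]
      change τ (((y p • u i : tangentSpace Z z) : TP z) e) = _
      have h2 : ((y p • u i : tangentSpace Z z) : TP z) e = (u i : TP z) p := by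
        conv_rhs => rw [hpe, map_smul]
        rfl
      rw [h2, huv]
      rfl
    simp only [← hco] at h1
    rw [eq_comm, ← map_smul, ← sub_eq_zero, ← map_sub, mkQ_apply, Quotient.mk_eq_zero, oscSpace,
      mem_homTo_iff p.2 hp0, hosc]
    rw [h.t_div p.2] at h1
    refine ⟨_, h1, ?_⟩
    have h3 : (θ - (∏ i, coeff (u i)) • Θ) p = θ p - (∏ i, coeff (u i)) • Θ p := rfl
    have h4 : Θ p = y p • z.submodule.mkQ (iteratedDeriv (k + 1) γ 0) := by
      rw [← hΘ, ← map_smul, ← hpe]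
    change _ = (θ - (∏ i, coeff (u i)) • Θ) p
    rw [h3, hθ, h4, map_sub, map_smul, smul_smul, mul_comm]
  have hBff : IsFundamentalForm (k + 1) Z z B := by
    refine ⟨fun σ u => ?_, fun p hp v hv u huv θ hθ => ?_⟩
    · rw [hB, hB]
      congr 1
      exact Equiv.prod_comp σ fun i => coeff (u i)
    · rw [hB]
      exact hval p hp v hv u huv θ hθ
  have hex : ∃! B, IsFundamentalForm (k + 1) Z z B := by
    refine ⟨B, hBff, fun B' hB' => MultilinearMap.ext fun u => ?_⟩
    -- Uniqueness: these tangent fields realize arbitrary u_i at e, so the defining property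
    -- prescribes every value.
    let v : Fin (k + 1) → W → W := fun i q => (coeff (u i) * y q) • deriv γ (t q / y q)
    obtain ⟨θ, hθ⟩ := exists_apply_eq he (z.submodule.mkQ (iterDeriv (k + 1) v (γ 0)))
    have hv : ∀ i, IsTangentField (affineCone Z) e (v i) := fun i =>
      h.isConeGraphAt.isTangentField _
    have huv : ∀ i, (u i : TP z) e = z.submodule.mkQ (v i e) := by
      intro i
      rw [hu]
      simp only [v, e, h.t_zero, zero_div, h.y_zero, mul_one]
    rw [hB'.eq e he v hv u huv θ hθ, hBff.eq e he v hv u huv θ hθ]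
  have hff : fundamentalForm (k + 1) Z z = B := by
    rw [fundamentalForm, dif_pos hex]
    exact hex.unique hex.choose_spec.1 hBff
  rw [hff]
  intro h0
  obtain ⟨θ, hθ⟩ := exists_apply_eq he (z.submodule.mkQ (deriv γ 0))
  have hθm : θ ∈ tangentSpace Z z := by
    rw [mem_homTo_iff h.mem h.ne_zero, htan]
    change θ e ∈ _
    rw [hθ]
    exact mem_map_of_mem (by simpa using iteratedDeriv_mem_jetSpan γ (le_refl 1) 0)
  have h1 : coeff ⟨θ, hθm⟩ = 1 := by
    change τ (θ e) = 1
    rw [hθ]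
    change t (deriv γ 0) = 1
    have := h.isConeGraphAt.deriv_t
    rwa [h.t_div h.mem] at this
  have h2 := hB fun _ => ⟨θ, hθm⟩
  simp only [h1, Finset.prod_const_one, one_smul, h0, zero_apply] at h2
  rw [eq_comm, mkQ_apply, Quotient.mk_eq_zero] at h2
  exact hΘmem h2

end IsConeGraph

theorem eventually_iteratedDeriv_mem [FiniteDimensional ℂ W] {S : Submodule ℂ W} {γ : ℂ → W}
    {s : ℂ} (hγ : AnalyticAt ℂ γ s) (h : ∀ᶠ x in 𝓝 s, γ x ∈ S) (j : ℕ) :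
    ∀ᶠ x in 𝓝 s, iteratedDeriv j γ x ∈ S := by
  have hS : IsClosed (S : Set W) := S.closed_of_finiteDimensional
  have : CompleteSpace W := FiniteDimensional.complete ℂ W
  induction j with
  | zero => simpa using h
  | succ j ih =>
    filter_upwards [ih.eventually_nhds, hγ.eventually_analyticAt] with x hx hxγ
    rw [iteratedDeriv_succ]
    have hd := (analyticAt_iteratedDeriv hxγ j).differentiableAt.hasDerivAt
    have h1 := S.mkQL.hasFDerivAt.comp_hasDerivAt x hd
    have h2 : S.mkQL ∘ iteratedDeriv j γ =ᶠ[𝓝 x] fun _ => 0 := by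
      filter_upwards [hx] with u hu
      exact (Quotient.mk_eq_zero S).2 hu
    exact (Quotient.mk_eq_zero S).1 (h1.unique ((hasDerivAt_const x _).congr_of_eventuallyEq h2))

namespace IsConeGraph

variable {Z : Set (ℙ ℂ W)} {z : ℙ ℂ W} {y t : W →L[ℂ] ℂ} {γ : ℂ → W} [FiniteDimensional ℂ W]

/-- The span of a piece of the cone near p contains γ(s) for small s, hence all derivatives of γ at
0, because a finite-dimensional subspace is closed under differentiation. -/
theorem isLinearlyNondegenerateAt (h : IsConeGraph Z z y t γ) {k : ℕ} (hk : jetSpan γ k 0 = ⊤) :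
    IsLinearlyNondegenerateAt Z z := by
  intro p hp hp0 N hN
  rw [eq_top_iff, ← hk, jetSpan_le]
  intro j _
  have hat := h.at_of_mem hp hp0
  refine (eventually_iteratedDeriv_mem h.analyticAt ?_ j).self_of_nhds
  have h1 : Tendsto (fun s => (y p, s)) (𝓝 (0 : ℂ)) (𝓝 (y p, t p / y p)) := by
    rw [h.t_div hp]
    have : ContinuousAt (fun s => (y p, s)) (0 : ℂ) := by fun_prop
    exact this
  have h2 : Tendsto (fun s => y p • γ s) (𝓝 (0 : ℂ)) (𝓝 p) := by
    have : Tendsto (fun s => y p • γ s) (𝓝 (0 : ℂ)) (𝓝 (y p • γ 0)) :=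
      h.analyticAt.continuousAt.const_smul (y p)
    rwa [← h.eq_smul hp] at this
  filter_upwards [h1.eventually hat.eventually_mem, h2.eventually_mem hN] with s hs hsN
  have := smul_mem _ (y p)⁻¹ (subset_span (R := ℂ) (Set.mem_inter hs hsN))
  rwa [smul_smul, inv_mul_cancel₀ hat.ne, one_smul] at this

/-- With G q = y(q) γ(t(q)/y(q)), the cone is {q = G q} near p, and q - G q lies in K = ker (y, t).
As G is constant along K, the projection of q - G q to K has derivative the identity on K. It is a
submersion with kernel of dimension dim W - dim K = 2. -/
theorem isSubmanifoldAt (h : IsConeGraph Z z y t γ) : IsSubmanifoldAt Z z 1 := by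
  refine ⟨h.mem_set, fun p hp hp0 => ?_⟩
  have hat := h.at_of_mem hp hp0
  let K : Submodule ℂ W := LinearMap.ker (y.prod t).toLinearMap
  have hKmem : ∀ {w : W}, w ∈ K ↔ y w = 0 ∧ t w = 0 := by
    intro w
    simp [K]
  have hsurj : LinearMap.range (y.prod t).toLinearMap = ⊤ := by
    rw [LinearMap.range_eq_top]
    rintro ⟨a, b⟩
    refine ⟨a • γ 0 + b • deriv γ 0, ?_⟩
    have h1 := h.isConeGraphAt.deriv_t
    have h2 := h.isConeGraphAt.deriv_y
    rw [h.t_div h.mem] at h1 h2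
    simp [h.y_zero, h.t_zero, h1, h2]
  have hK : finrank ℂ K + 2 = finrank ℂ W := by
    have := (y.prod t).toLinearMap.finrank_range_add_finrank_ker
    rw [hsurj, finrank_top] at this
    simp only [finrank_prod, finrank_self] at this
    rw [← this, add_comm]
  let e : K ≃ₗ[ℂ] (Fin (finrank ℂ K) → ℂ) := (finBasis ℂ K).equivFun
  obtain ⟨P₀, hP₀⟩ := LinearMap.exists_extend e.toLinearMap
  let P : W →L[ℂ] (Fin (finrank ℂ K) → ℂ) := LinearMap.toContinuousLinearMap P₀
  have hP : ∀ {w : W} (hw : w ∈ K), P w = e ⟨w, hw⟩ := fun hw => LinearMap.congr_fun hP₀ ⟨_, hw⟩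
  let G : W → W := fun q => y q • γ (t q / y q)
  have hG : AnalyticAt ℂ G p :=
    (y.analyticAt p).smul (AnalyticAt.fun_comp hat.analyticAt hat.analyticAt_div)
  have hGK : ∀ w ∈ K, fderiv ℂ G p w = 0 := by
    intro w hw
    obtain ⟨hy, ht⟩ := hKmem.1 hw
    have hl : HasDerivAt (fun ε : ℂ => p + ε • w) w 0 := by
      simpa using ((hasDerivAt_id (0 : ℂ)).smul_const w).const_add p
    have h1 : HasDerivAt (fun ε : ℂ => G (p + ε • w)) _ 0 :=
      HasFDerivAt.comp_hasDerivAt_of_eq (0 : ℂ) hG.differentiableAt.hasFDerivAt hl (by simp)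
    have h2 : (fun ε : ℂ => G (p + ε • w)) = fun _ => G p := by
      funext ε
      simp [G, hy, ht]
    rw [h2] at h1
    exact h1.unique (hasDerivAt_const _ _)
  have hg : HasFDerivAt (fun q => P (q - G q)) (P.comp (ContinuousLinearMap.id ℂ W - fderiv ℂ G p))
      p := P.hasFDerivAt.comp p ((hasFDerivAt_id p).sub hG.differentiableAt.hasFDerivAt)
  have hgs : Function.Surjective (fderiv ℂ (fun q => P (q - G q)) p) := by
    intro u
    refine ⟨(e.symm u : K), ?_⟩
    rw [hg.fderiv]
    simp only [ContinuousLinearMap.comp_apply, sub_apply, ContinuousLinearMap.id_apply,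
      hGK _ (e.symm u).2, sub_zero]
    rw [hP (e.symm u).2]
    simp
  refine ⟨finrank ℂ K, fun q => P (q - G q), ?_, hgs, ?_, ?_⟩
  · exact (P.analyticAt _).fun_comp (analyticAt_id.sub hG)
  · have := (fderiv ℂ (fun q => P (q - G q)) p).toLinearMap.finrank_range_add_finrank_ker
    rw [LinearMap.range_eq_top.2 hgs, finrank_top, finrank_fin_fun, ← hK] at this
    omega
  · filter_upwards [hat.mem_iff, hat.tendsto_div.eventually hat.y_eq,
      hat.tendsto_div.eventually hat.t_eq, y.continuous.continuousAt.eventually_ne hat.ne]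
      with q h1 h2 h3 h4
    have hqK : q - G q ∈ K := by
      rw [hKmem]
      simp only [G, map_sub, map_smul, h2, h3, smul_eq_mul, mul_one, sub_self, true_and]
      rw [mul_div_cancel₀ _ h4, sub_self]
    rw [h1, hP hqK, LinearEquiv.map_eq_zero_iff, ← sub_eq_zero]
    exact (Subtype.ext_iff (a1 := ⟨q - G q, hqK⟩) (a2 := (0 : K))).symm

end IsConeGraph

end ConeGraph

/-! ### Taylor coefficients and division by the parameter -/

section Jets

variable {W : Type*} [NormedAddCommGroup W] [NormedSpace ℂ W]

/-- The derivatives at the origin of a function with a given Taylor expansion. -/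
theorem iteratedDeriv_of_eventuallyEq [CompleteSpace W] {n : ℕ} {f K : ℂ → W} {a : ℕ → W}
    (hK : AnalyticAt ℂ K 0) (hKn : K 0 = a n)
    (hf : f =ᶠ[𝓝 0] fun s => ∑ i ∈ Finset.range n, s ^ i • a i + s ^ n • K s) {j : ℕ} (hj : j ≤ n) :
    iteratedDeriv j f 0 = (j.factorial : ℂ) • a j := by
  induction n generalizing f K a j with
  | zero =>
    obtain rfl : j = 0 := by omega
    simp [hf.eq_of_nhds, hKn]
  | succ n ih =>
    cases j with
    | zero => simp [hf.eq_of_nhds, Finset.sum_range_succ']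
    | succ j =>
      rw [iteratedDeriv_succ']
      -- The derivative of the expansion is again one, with coefficients (i + 1) a_{i+1} and this
      -- function as remainder.
      have hK' : AnalyticAt ℂ (fun s => ((n : ℂ) + 1) • K s + s • deriv K s) 0 :=
        (analyticAt_const.smul hK).add (analyticAt_id.smul hK.deriv)
      rw [ih (a := fun i => ((i : ℂ) + 1) • a (i + 1)) hK' (by simp [hKn]) ?_ (by omega)]
      · rw [smul_smul, Nat.factorial_succ]
        push_cast
        ring_nf
      · filter_upwards [hf.eventuallyEq_nhds, hK.eventually_analyticAt] with s hs hKs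
        rw [hs.deriv_eq]
        have h1 : ∀ i ∈ Finset.range (n + 1), HasDerivAt (fun s : ℂ => s ^ i • a i)
            (((i : ℂ) * s ^ (i - 1)) • a i) s := fun i _ => (hasDerivAt_pow i s).smul_const _
        have h2 := (HasDerivAt.fun_sum h1).add
          ((hasDerivAt_pow (n + 1) s).smul hKs.differentiableAt.hasDerivAt)
        refine h2.deriv.trans ?_
        rw [Finset.sum_range_succ']
        simp only [Nat.cast_zero, zero_mul, zero_smul, add_zero, Nat.add_sub_cancel, smul_add,
          smul_smul]
        push_cast
        congr 1
        · exact Finset.sum_congr rfl fun i _ => by rw [mul_comm]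
        · rw [add_comm, mul_comm (s ^ n), pow_succ]

theorem eventuallyEq_of_smul {f g : ℂ → W} (hf : AnalyticAt ℂ f 0) (hg : AnalyticAt ℂ g 0)
    (h : ∀ᶠ s in 𝓝 (0 : ℂ), s • f s = s • g s) : f =ᶠ[𝓝 0] g := by
  refine (hf.frequently_eq_iff_eventually_eq hg).1 (Eventually.frequently ?_)
  filter_upwards [mem_nhdsWithin_of_mem_nhds h, self_mem_nhdsWithin] with s hs hs0
  exact smul_right_injective W hs0 hs

end Jets

/-! ### The equations of lines and the Taylor expansion of their solution -/

section LineEquation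

variable (m n : ℂ)

/-- The quadratic part, in the dependent coordinates, of the equations of lines. -/
def quadPart (u : Fin 4 → ℂ) : Fin 4 → ℂ :=
  ![m * u 0 ^ 2, n * u 1 ^ 2, n * u 0 ^ 2, m * u 1 ^ 2]

/-- The cubic part, in the dependent coordinates, of the equations of lines. -/
def cubicPart (u : Fin 4 → ℂ) : Fin 4 → ℂ :=
  ![m ^ 2 * u 2 ^ 3, n ^ 2 * u 3 ^ 3, 2 * m * n * u 2 ^ 3 + m ^ 2 * u 3 ^ 3,
    2 * m * n * u 3 ^ 3 + n ^ 2 * u 2 ^ 3]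

/-- The coefficients of `τ ^ 2` in the equations of lines. -/
def quadCoeff : Fin 4 → ℂ := ![m, n, m + n, m + n]

/-- The coefficients of `τ ^ 3` in the equations of lines. -/
def cubicCoeff : Fin 4 → ℂ := ![m ^ 2, n ^ 2, 2 * m * n + m ^ 2, 2 * m * n + n ^ 2]

/-- The coefficients of the quartic terms in the equations of lines. -/
def quarticCoeff : Fin 4 → ℂ := ![m ^ 3, n ^ 3, 3 * m ^ 2 * n, 3 * m * n ^ 2]

/-- The equations of the lines on the quartic through a point of `ℓ`, in an affine chart of the
projectivized tangent space. -/
def lineEq (u : Fin 4 → ℂ) (τ : ℂ) : Fin 4 → ℂ :=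
  u + (quadPart m n u + τ ^ 2 • quadCoeff m n) + (cubicPart m n u + τ ^ 3 • cubicCoeff m n)
    + (∑ i, u i ^ 4 + τ ^ 4) • quarticCoeff m n

theorem quadPart_smul (c : ℂ) (u : Fin 4 → ℂ) : quadPart m n (c • u) = c ^ 2 • quadPart m n u := by
  ext i; fin_cases i <;> simp [quadPart] <;> ring

theorem cubicPart_smul (c : ℂ) (u : Fin 4 → ℂ) :
    cubicPart m n (c • u) = c ^ 3 • cubicPart m n u := by
  ext i; fin_cases i <;> simp [cubicPart] <;> ring

/-- The decomposition by degree: it yields the derivative at the origin, and it allows division by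
powers of τ after substituting u = τV. -/
theorem lineEq_smul (c : ℂ) (u : Fin 4 → ℂ) (σ : ℂ) : lineEq m n (c • u) (c * σ) =
    c • u + c ^ 2 • (quadPart m n u + σ ^ 2 • quadCoeff m n)
      + c ^ 3 • (cubicPart m n u + σ ^ 3 • cubicCoeff m n)
      + c ^ 4 • (∑ i, u i ^ 4 + σ ^ 4) • quarticCoeff m n := by
  simp only [lineEq, quadPart_smul, cubicPart_smul, Pi.smul_apply, smul_eq_mul, mul_pow, smul_add,
    smul_smul, ← Finset.mul_sum, mul_add]

variable {m n} in
theorem analyticAt_quadPart {E : Type*} [NormedAddCommGroup E] [NormedSpace ℂ E]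
    {f : E → Fin 4 → ℂ} {x : E} (hf : AnalyticAt ℂ f x) :
    AnalyticAt ℂ (fun w => quadPart m n (f w)) x := by
  have := fun i => (ContinuousLinearMap.proj (R := ℂ) (φ := fun _ : Fin 4 => ℂ) i).analyticAt (f x)
    |>.fun_comp hf
  simp only [ContinuousLinearMap.proj_apply] at this
  rw [analyticAt_pi_iff]
  intro i
  have h0 := this 0; have h1 := this 1
  fin_cases i
  · exact analyticAt_const.mul (h0.fun_pow 2)
  · exact analyticAt_const.mul (h1.fun_pow 2)
  · exact analyticAt_const.mul (h0.fun_pow 2)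
  · exact analyticAt_const.mul (h1.fun_pow 2)

variable {m n} in
theorem analyticAt_cubicPart {E : Type*} [NormedAddCommGroup E] [NormedSpace ℂ E]
    {f : E → Fin 4 → ℂ} {x : E} (hf : AnalyticAt ℂ f x) :
    AnalyticAt ℂ (fun w => cubicPart m n (f w)) x := by
  have := fun i => (ContinuousLinearMap.proj (R := ℂ) (φ := fun _ : Fin 4 => ℂ) i).analyticAt (f x)
    |>.fun_comp hf
  simp only [ContinuousLinearMap.proj_apply] at this
  rw [analyticAt_pi_iff]
  intro i
  have h2 := this 2; have h3 := this 3
  fin_cases i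
  · exact analyticAt_const.mul (h2.fun_pow 3)
  · exact analyticAt_const.mul (h3.fun_pow 3)
  · exact (analyticAt_const.mul (h2.fun_pow 3)).add (analyticAt_const.mul (h3.fun_pow 3))
  · exact (analyticAt_const.mul (h3.fun_pow 3)).add (analyticAt_const.mul (h2.fun_pow 3))

theorem analyticAt_sum_pow {E : Type*} [NormedAddCommGroup E] [NormedSpace ℂ E]
    {f : E → Fin 4 → ℂ} {x : E} (hf : AnalyticAt ℂ f x) :
    AnalyticAt ℂ (fun w => ∑ i, f w i ^ 4) x := by
  refine Finset.analyticAt_fun_sum _ fun i _ => AnalyticAt.fun_pow ?_ 4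
  exact (ContinuousLinearMap.proj (R := ℂ) (φ := fun _ : Fin 4 => ℂ) i).analyticAt (f x)
    |>.fun_comp hf

theorem analyticAt_lineEq (x : (Fin 4 → ℂ) × ℂ) :
    AnalyticAt ℂ (fun w : (Fin 4 → ℂ) × ℂ => lineEq m n w.1 w.2) x := by
  have h := analyticAt_quadPart (m := m) (n := n) (analyticAt_fst (𝕜 := ℂ) (p := x))
  have h' := analyticAt_cubicPart (m := m) (n := n) (analyticAt_fst (𝕜 := ℂ) (p := x))
  have h'' := analyticAt_sum_pow (analyticAt_fst (𝕜 := ℂ) (p := x))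
  have hs : AnalyticAt ℂ (fun w : (Fin 4 → ℂ) × ℂ => w.2) x := analyticAt_snd
  exact ((analyticAt_fst.add (h.add ((hs.fun_pow 2).smul analyticAt_const))).add
    (h'.add ((hs.fun_pow 3).smul analyticAt_const))).add
    ((h''.add (hs.fun_pow 4)).smul analyticAt_const)

theorem hasFDerivAt_lineEq :
    HasFDerivAt (fun w : (Fin 4 → ℂ) × ℂ => lineEq m n w.1 w.2)
      (ContinuousLinearMap.fst ℂ (Fin 4 → ℂ) ℂ) 0 := by
  have h := (analyticAt_lineEq m n 0).differentiableAt.hasFDerivAt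
  suffices hfst : fderiv ℂ (fun w : (Fin 4 → ℂ) × ℂ => lineEq m n w.1 w.2) 0 =
      ContinuousLinearMap.fst ℂ (Fin 4 → ℂ) ℂ by rwa [hfst] at h
  refine ContinuousLinearMap.ext fun w => ?_
  have hl : HasDerivAt (fun ε : ℂ => ε • w) w 0 := by
    simpa using (hasDerivAt_id (0 : ℂ)).smul_const w
  have h1 := h.comp_hasDerivAt_of_eq (0 : ℂ) hl (by simp)
  have h2 : ∀ (k : ℕ) (v : Fin 4 → ℂ), HasDerivAt (fun ε : ℂ => ε ^ (k + 2) • v) 0 0 := fun k v => by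
    simpa using (hasDerivAt_pow (k + 2) (0 : ℂ)).smul_const v
  have h3 : HasDerivAt (fun ε : ℂ => ε • w.1) w.1 0 := by
    simpa using (hasDerivAt_id (0 : ℂ)).smul_const w.1
  have h4 := ((h3.add (h2 0 (quadPart m n w.1 + w.2 ^ 2 • quadCoeff m n))).add
    (h2 1 (cubicPart m n w.1 + w.2 ^ 3 • cubicCoeff m n))).add
    (h2 2 ((∑ i, w.1 i ^ 4 + w.2 ^ 4) • quarticCoeff m n))
  rw [add_zero, add_zero, add_zero] at h4
  refine Eq.symm <| h4.unique (h1.congr_of_eventuallyEq (Eventually.of_forall fun ε => ?_))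
  exact (lineEq_smul m n ε w.1 w.2).symm

/-- Near the origin, the solutions of `lineEq` form the graph of an analytic function. -/
theorem exists_implicit : ∃ U : ℂ → Fin 4 → ℂ, AnalyticAt ℂ U 0 ∧ U 0 = 0 ∧
    ∀ᶠ w in 𝓝 (0 : (Fin 4 → ℂ) × ℂ), lineEq m n w.1 w.2 = 0 ↔ w.1 = U w.2 := by
  -- This map has derivative the identity at 0. Solutions of the equations correspond to points (0,
  -- τ) under its local inverse.
  let Φ : (Fin 4 → ℂ) × ℂ → (Fin 4 → ℂ) × ℂ := fun w => (lineEq m n w.1 w.2, w.2)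
  have hΦ0 : Φ 0 = 0 := by
    have := lineEq_smul m n 0 0 0
    simp at this
    simp [Φ, this]
  have hΦa : AnalyticAt ℂ Φ 0 := (analyticAt_lineEq m n 0).prod analyticAt_snd
  have hΦd : HasFDerivAt Φ (ContinuousLinearMap.id ℂ ((Fin 4 → ℂ) × ℂ)) 0 :=
    (hasFDerivAt_lineEq m n).prodMk hasFDerivAt_snd
  have hΦs : HasStrictFDerivAt Φ
      (ContinuousLinearEquiv.refl ℂ ((Fin 4 → ℂ) × ℂ) : _ →L[ℂ] (Fin 4 → ℂ) × ℂ) 0 := by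
    have := hΦa.hasStrictFDerivAt
    rwa [hΦd.fderiv] at this
  let e := hΦs.toOpenPartialHomeomorph Φ
  have hes : (0 : (Fin 4 → ℂ) × ℂ) ∈ e.source := hΦs.mem_toOpenPartialHomeomorph_source
  have he : ∀ w, e w = Φ w := fun _ => rfl
  have hinv : e.symm 0 = 0 := by
    have := e.left_inv hes
    rwa [he, hΦ0] at this
  have hsymm : AnalyticAt ℂ e.symm 0 := by
    have := e.analyticAt_symm' (i := ContinuousLinearEquiv.refl ℂ _) hes hΦa
      (by rw [← hΦs.hasFDerivAt.fderiv]; rfl)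
    rwa [he, hΦ0] at this
  have hleft : ∀ᶠ w in 𝓝 (0 : (Fin 4 → ℂ) × ℂ), e.symm (Φ w) = w := e.eventually_left_inverse hes
  have hright : ∀ᶠ w in 𝓝 (0 : (Fin 4 → ℂ) × ℂ), Φ (e.symm w) = w := by
    have := e.eventually_right_inverse' hes
    rwa [he, hΦ0] at this
  have hc : Tendsto (fun w : (Fin 4 → ℂ) × ℂ => ((0 : Fin 4 → ℂ), w.2)) (𝓝 0) (𝓝 0) := by
    have : ContinuousAt (fun w : (Fin 4 → ℂ) × ℂ => ((0 : Fin 4 → ℂ), w.2)) 0 := by fun_prop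
    exact this
  refine ⟨fun τ => (e.symm (0, τ)).1, ?_, ?_, ?_⟩
  · have h1 : AnalyticAt ℂ (fun τ : ℂ => ((0 : Fin 4 → ℂ), τ)) 0 := by fun_prop
    exact analyticAt_fst.fun_comp (AnalyticAt.fun_comp (g := e.symm) hsymm h1)
  · change (e.symm 0).1 = 0
    rw [hinv]; rfl
  · filter_upwards [hleft, hc.eventually hright] with w h1 h2
    constructor
    · intro h
      have h3 : Φ w = (0, w.2) := by simp [Φ, h]
      rw [h3] at h1
      rw [h1]
    · intro h
      have h3 : (e.symm (0, w.2)).2 = w.2 := by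
        have := congrArg Prod.snd h2
        exact this
      have h4 : lineEq m n (e.symm (0, w.2)).1 (e.symm (0, w.2)).2 = 0 := by
        have := congrArg Prod.fst h2
        exact this
      rwa [h3, ← h] at h4

/-- The Taylor expansion up to order four of the solution of `lineEq`. -/
theorem exists_jet {U : ℂ → Fin 4 → ℂ} (hU : AnalyticAt ℂ U 0) (hU0 : U 0 = 0)
    (h : ∀ᶠ τ in 𝓝 (0 : ℂ), lineEq m n (U τ) τ = 0) : ∃ K : ℂ → Fin 4 → ℂ, AnalyticAt ℂ K 0 ∧
      K 0 = -(quarticCoeff m n + quadPart m n (quadCoeff m n)) ∧ ∀ᶠ τ in 𝓝 (0 : ℂ),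
        U τ = -(τ ^ 2 • quadCoeff m n) - τ ^ 3 • cubicCoeff m n + τ ^ 4 • K τ := by
  obtain ⟨p, hp⟩ := hU
  have hV : AnalyticAt ℂ (dslope U 0) 0 := ⟨_, hp.has_fpower_series_dslope_fslope⟩
  set V := dslope U 0
  have hUV : ∀ τ, U τ = τ • V τ := fun τ => by
    have := sub_smul_dslope U 0 τ
    rw [sub_zero, hU0, sub_zero] at this
    exact this.symm
  -- With U = τV, the equation divided by τ reads V = τH, so U = τ²H.
  let H : ℂ → Fin 4 → ℂ := fun τ => -((quadPart m n (V τ) + quadCoeff m n)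
    + τ • (cubicPart m n (V τ) + cubicCoeff m n) + τ ^ 2 • (∑ i, V τ i ^ 4 + 1) • quarticCoeff m n)
  have hq := analyticAt_quadPart (m := m) (n := n) hV
  have hcu := analyticAt_cubicPart (m := m) (n := n) hV
  have hs := analyticAt_sum_pow hV
  have hH : AnalyticAt ℂ H 0 := by fun_prop
  have hVH : ∀ᶠ τ in 𝓝 (0 : ℂ), V τ = τ • H τ := by
    refine eventuallyEq_of_smul hV (analyticAt_id.smul hH) ?_
    filter_upwards [h] with τ hτ
    have h1 := lineEq_smul m n τ (V τ) 1
    rw [mul_one, ← hUV, hτ] at h1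
    rw [← hUV, ← sub_eq_zero]
    simp only [H, one_pow, one_smul] at h1 ⊢
    rw [h1]
    module
  have hV0 : V 0 = 0 := by rw [hVH.self_of_nhds, zero_smul]
  have hH0 : H 0 = -quadCoeff m n := by
    have := quadPart_smul m n 0 0
    simp only [smul_zero, ne_eq, OfNat.ofNat_ne_zero, not_false_eq_true, zero_pow, zero_smul] at this
    simp [H, hV0, this]
  have hq' := analyticAt_quadPart (m := m) (n := n) hH
  have hcu' := analyticAt_cubicPart (m := m) (n := n) hH
  have hs' := analyticAt_sum_pow hH
  -- Substituting V = τH into the definition of H gives H = -quadCoeff - τ cubicCoeff + τ²K with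
  -- this K.
  refine ⟨fun τ => -(quarticCoeff m n + quadPart m n (H τ) + τ ^ 2 • cubicPart m n (H τ)
    + τ ^ 4 • (∑ i, H τ i ^ 4) • quarticCoeff m n), by fun_prop, ?_, ?_⟩
  · have := quadPart_smul m n (-1) (quadCoeff m n)
    simp only [neg_smul, one_smul, even_two, Even.neg_pow, one_pow] at this
    simp [hH0, this]
  · filter_upwards [hVH] with τ hτ
    have h1 : H τ = -((quadPart m n (τ • H τ) + quadCoeff m n)
      + τ • (cubicPart m n (τ • H τ) + cubicCoeff m n)
      + τ ^ 2 • (∑ i, (τ • H τ) i ^ 4 + 1) • quarticCoeff m n) := by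
      rw [← hτ]
    simp only [quadPart_smul, cubicPart_smul, Pi.smul_apply, smul_eq_mul, mul_pow,
      ← Finset.mul_sum] at h1
    rw [hUV, hτ]
    generalize quadPart m n (H τ) = A at *
    generalize cubicPart m n (H τ) = B at *
    generalize ∑ i, H τ i ^ 4 = C at *
    rw [h1]
    module

end LineEquation

/-! ### The VMRT of the quartic near ℓ_x in coordinates -/

/-- The only candidate for a line with direction θ is the span of e and v, which is two-dimensional
since θ ≠ 0. -/
theorem mem_affineCone_vmrt {n : ℕ} {f : MvPolynomial (Fin n) ℂ} {x : ℙ ℂ (Fin n → ℂ)}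
    {θ : TX f x} (hθ : θ ≠ 0) {e : x.submodule} (he : e ≠ 0) {v : Fin n → ℂ}
    (hv : (θ : TP x) e = x.submodule.mkQ v) : θ ∈ affineCone (vmrt f x) ↔
      ∀ s r : ℂ, MvPolynomial.eval (s • (e : Fin n → ℂ) + r • v) f = 0 := by
  have he' : (e : Fin n → ℂ) ≠ 0 := fun h => he (Subtype.ext h)
  constructor
  · rintro ⟨z, ⟨L, hL, rfl⟩, hz⟩ s r
    rw [lineDirection, Projectivization.submodule_mk''] at hz
    have h1 := (mem_homTo_iff e.2 he').1 hz
    change (θ : TP x) e ∈ _ at h1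
    rw [hv] at h1
    have h2 : v ∈ L := by
      obtain ⟨w, hw, hwv⟩ := h1
      rw [← sub_eq_zero, ← map_sub, mkQ_apply, Quotient.mk_eq_zero] at hwv
      rw [← sub_sub_cancel w v]
      exact sub_mem hw (hL.mem hwv)
    exact hL.subset _ (add_mem (smul_mem _ _ (hL.mem e.2)) (smul_mem _ _ h2))
  · intro h
    have hli : LinearIndependent ℂ ![(e : Fin n → ℂ), v] := by
      rw [LinearIndependent.pair_iff' he']
      rintro c rfl
      refine hθ (Subtype.ext (TP.ext_of_ne_zero he ?_))
      rw [hv, mkQ_apply, (Quotient.mk_eq_zero _).2 (smul_mem _ _ e.2)]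
      rfl
    have hL : IsLineThrough f x (span ℂ (Set.range ![(e : Fin n → ℂ), v])) := by
      refine ⟨by simpa using finrank_span_eq_card hli, fun p hp => ?_, fun p hp => ?_⟩
      · obtain ⟨c, rfl⟩ := exists_smul_of_mem_submodule e.2 he' hp
        exact smul_mem _ _ (subset_span ⟨0, rfl⟩)
      · rw [Matrix.range_cons, Matrix.range_cons, Matrix.range_empty, Set.union_empty,
          Set.singleton_union, mem_span_pair] at hp
        obtain ⟨s, r, rfl⟩ := hp
        exact h s r
    refine ⟨_, ⟨_, hL, rfl⟩, ?_⟩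
    rw [lineDirection, Projectivization.submodule_mk'']
    refine (mem_homTo_iff e.2 he').2 ?_
    change (θ : TP x) e ∈ _
    rw [hv]
    exact mem_map_of_mem (subset_span ⟨1, rfl⟩)

section LinesThroughPoint

variable {a b c d : ℂ}

theorem eval_quartic_line (h : a * d - b * c = 1) (u : Fin 4 → ℂ) (τ s r : ℂ) :
    MvPolynomial.eval (s • ![a, b, 0, 0, 0, 0, 0] + r • ![c, d, u 0, u 1, u 2, u 3, τ]) quartic =
      r * ((s * a + r * c) ^ 3 * lineEq (-b) a u τ 0 + (s * b + r * d) ^ 3 * lineEq (-b) a u τ 1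
        + (s * a + r * c) ^ 2 * (s * b + r * d) * lineEq (-b) a u τ 2
        + (s * a + r * c) * (s * b + r * d) ^ 2 * lineEq (-b) a u τ 3) := by
  -- Expressing r through the coordinates X, Y of the line makes the quotient by r a binary cubic,
  -- with m = -b and n = a.
  have hr : r = -b * (s * a + r * c) + a * (s * b + r * d) := by linear_combination -r * h
  simp [quartic, lineEq, quadPart, cubicPart, quadCoeff, cubicCoeff, quarticCoeff, Fin.sum_univ_four,
    -Matrix.add_cons, -Matrix.cons_add]
  generalize s * a + r * c = X at *
  generalize s * b + r * d = Y at *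
  subst hr
  ring

/-- Since ad - bc = 1, the pair (X, Y) takes all values. A product of binary forms vanishes
identically only if a factor does, and -bX + aY is not zero. -/
theorem eval_quartic_line_iff (h : a * d - b * c = 1) (u : Fin 4 → ℂ) (τ : ℂ) :
    (∀ s r : ℂ, MvPolynomial.eval
      (s • ![a, b, 0, 0, 0, 0, 0] + r • ![c, d, u 0, u 1, u 2, u 3, τ]) quartic = 0) ↔
      lineEq (-b) a u τ = 0 := by
  simp only [eval_quartic_line h]
  generalize lineEq (-b) a u τ = E
  constructor
  · intro H
    have key : ∀ X Y : ℂ, (-b * X + a * Y) *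
        (X ^ 3 * E 0 + Y ^ 3 * E 1 + X ^ 2 * Y * E 2 + X * Y ^ 2 * E 3) = 0 := by
      intro X Y
      have h1 := H (d * X - c * Y) (-b * X + a * Y)
      rwa [show (d * X - c * Y) * a + (-b * X + a * Y) * c = X by linear_combination X * h,
        show (d * X - c * Y) * b + (-b * X + a * Y) * d = Y by linear_combination Y * h] at h1
    have k0 := key 1 0
    have k1 := key 0 1
    have k2 := key 1 1
    have k3 := key 1 (-1)
    have k4 := key 1 2
    -- Five values determine the binary quartic: `q0`, …, `q4` express the vanishing of the
    -- coefficients of X⁴, X³Y, X²Y², XY³, Y⁴.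
    have q0 : b * E 0 = 0 := by linear_combination -k0
    have q4 : a * E 1 = 0 := by linear_combination k1
    have q2 : a * E 2 - b * E 3 = 0 := by linear_combination (k2 + k3) / 2 + q0 - q4
    have q3 : a * E 3 - b * E 1 = 0 := by
      linear_combination (k4 - 2 * k2) / 6 - q0 / 6 - q4 * 14 / 6 - q2 * 2 / 6
    have q1 : a * E 0 - b * E 2 = 0 := by linear_combination k2 + q0 - q4 - q2 - q3
    have hE : E 0 = 0 ∧ E 1 = 0 ∧ E 2 = 0 ∧ E 3 = 0 := by
      by_cases hb : b = 0
      · have ha : a ≠ 0 := by rintro rfl; simp [hb] at h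
        subst hb
        simp only [zero_mul, sub_zero, mul_eq_zero, ha, false_or] at q1 q2 q3 q4
        exact ⟨q1, q4, q2, q3⟩
      · have e0 : E 0 = 0 := by simpa [hb] using q0
        have e2 : E 2 = 0 := by simpa [hb, e0] using q1
        have e3 : E 3 = 0 := by simpa [hb, e2] using q2
        have e1 : E 1 = 0 := by simpa [hb, e3] using q3
        exact ⟨e0, e1, e2, e3⟩
    ext i
    fin_cases i
    exacts [hE.1, hE.2.1, hE.2.2.1, hE.2.2.2]
  · rintro rfl s r
    simp

theorem eval_pderiv_quartic (r a b : ℂ) (i : Fin 7) :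
    MvPolynomial.eval (r • ![a, b, 0, 0, 0, 0, 0]) (MvPolynomial.pderiv i quartic) =
      r ^ 3 * (![0, 0, a ^ 3, b ^ 3, a ^ 2 * b, a * b ^ 2, 0] : Fin 7 → ℂ) i := by
  fin_cases i <;>
    simp [quartic, MvPolynomial.pderiv_X] <;> ring

theorem mem_affineTangent_quartic {x : ℙ ℂ (Fin 7 → ℂ)}
    (hx : ![a, b, 0, 0, 0, 0, 0] ∈ x.submodule) (h0 : (![a, b, 0, 0, 0, 0, 0] : Fin 7 → ℂ) ≠ 0)
    {v : Fin 7 → ℂ} : v ∈ affineTangent quartic x ↔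
      a ^ 3 * v 2 + b ^ 3 * v 3 + a ^ 2 * b * v 4 + a * b ^ 2 * v 5 = 0 := by
  have key : ∀ r : ℂ, ∑ i, MvPolynomial.eval (r • ![a, b, 0, 0, 0, 0, 0])
      (MvPolynomial.pderiv i quartic) * v i =
      r ^ 3 * (a ^ 3 * v 2 + b ^ 3 * v 3 + a ^ 2 * b * v 4 + a * b ^ 2 * v 5) := by
    intro r
    simp only [Fin.sum_univ_seven, eval_pderiv_quartic]
    simp
    ring
  constructor
  · intro hv
    have := hv _ hx
    rw [← one_smul ℂ ![a, b, 0, 0, 0, 0, 0], key, one_pow, one_mul] at this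
    exact this
  · intro hv p hp
    obtain ⟨r, rfl⟩ := exists_smul_of_mem_submodule hx h0 hp
    rw [key, hv, mul_zero]

/-- Coordinates on the quotient of `ℂ^7` by the line through `(a, b, 0, …, 0)`. -/
def quotCoord (a b : ℂ) : (Fin 7 → ℂ) →ₗ[ℂ] (Fin 6 → ℂ) where
  toFun v := ![a * v 1 - b * v 0, v 2, v 3, v 4, v 5, v 6]
  map_add' v w := by ext i; fin_cases i <;> simp; ring
  map_smul' r v := by ext i; fin_cases i <;> simp; ring

theorem quotCoord_eq_zero_iff (h : a * d - b * c = 1) {v : Fin 7 → ℂ} :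
    quotCoord a b v = 0 ↔ v ∈ span ℂ {(![a, b, 0, 0, 0, 0, 0] : Fin 7 → ℂ)} := by
  rw [mem_span_singleton]
  constructor
  · intro hv
    have h' : ∀ i, quotCoord a b v i = 0 := fun i => by rw [hv]; rfl
    have h0 : a * v 1 - b * v 0 = 0 := h' 0
    refine ⟨d * v 0 - c * v 1, ?_⟩
    ext i
    fin_cases i
    · simp; linear_combination v 0 * h - c * h0
    · simp; linear_combination v 1 * h - d * h0
    · simpa [quotCoord] using (h' 1).symm
    · simpa [quotCoord] using (h' 2).symm
    · simpa [quotCoord] using (h' 3).symm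
    · simpa [quotCoord] using (h' 4).symm
    · simpa [quotCoord] using (h' 5).symm
  · rintro ⟨r, rfl⟩
    ext i
    fin_cases i <;> simp [quotCoord]
    ring

theorem exists_coord (h : a * d - b * c = 1) {x : ℙ ℂ (Fin 7 → ℂ)}
    (hx : ![a, b, 0, 0, 0, 0, 0] ∈ x.submodule) (h0 : (![a, b, 0, 0, 0, 0, 0] : Fin 7 → ℂ) ≠ 0) :
    ∃ coord : TX quartic x →ₗ[ℂ] (Fin 6 → ℂ), Function.Injective coord ∧
      (∀ (θ : TX quartic x) v, (θ : TP x) ⟨_, hx⟩ = x.submodule.mkQ v → coord θ = quotCoord a b v) ∧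
      ∀ θ, a ^ 3 * coord θ 1 + b ^ 3 * coord θ 2 + a ^ 2 * b * coord θ 3
        + a * b ^ 2 * coord θ 4 = 0 := by
  have hxs : x.submodule = span ℂ {(![a, b, 0, 0, 0, 0, 0] : Fin 7 → ℂ)} := by
    refine le_antisymm (fun p hp => ?_) ((span_singleton_le_iff_mem _ _).2 hx)
    obtain ⟨r, rfl⟩ := exists_smul_of_mem_submodule hx h0 hp
    exact smul_mem _ _ (mem_span_singleton_self _)
  let e : x.submodule := ⟨_, hx⟩
  have he : e ≠ 0 := fun h => h0 (congrArg Subtype.val h)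
  let F : ((Fin 7 → ℂ) ⧸ x.submodule) →ₗ[ℂ] (Fin 6 → ℂ) := x.submodule.liftQ (quotCoord a b)
    fun p hp => (quotCoord_eq_zero_iff h).2 (hxs ▸ hp)
  let coord : TX quartic x →ₗ[ℂ] (Fin 6 → ℂ) :=
    { toFun := fun θ => F ((θ : TP x) e)
      map_add' := fun θ η => F.map_add _ _
      map_smul' := fun r θ => F.map_smul _ _ }
  have hcoord : ∀ (θ : TX quartic x) v, (θ : TP x) ⟨_, hx⟩ = x.submodule.mkQ v →
      coord θ = quotCoord a b v := by
    intro θ v hv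
    change F ((θ : TP x) e) = _
    rw [hv]
    rfl
  refine ⟨coord, ?_, hcoord, fun θ => ?_⟩
  · rw [← LinearMap.ker_eq_bot, LinearMap.ker_eq_bot']
    intro θ hθ
    obtain ⟨v, hv⟩ := x.submodule.mkQ_surjective ((θ : TP x) e)
    rw [hcoord θ v hv.symm, quotCoord_eq_zero_iff h, ← hxs, ← Quotient.mk_eq_zero, ← mkQ_apply,
      hv] at hθ
    exact Subtype.ext (TP.ext_of_ne_zero he hθ)
  · obtain ⟨v, hv, hvθ⟩ := θ.2 e
    rw [hcoord θ v hvθ.symm]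
    exact (mem_affineTangent_quartic hx h0).1 hv

end LinesThroughPoint

theorem iteratedDeriv_clm_comp {E F : Type*} [NormedAddCommGroup E] [NormedSpace ℂ E]
    [CompleteSpace E] [NormedAddCommGroup F] [NormedSpace ℂ F] (L : E →L[ℂ] F) {γ : ℂ → E} {s : ℂ}
    (hγ : AnalyticAt ℂ γ s) (j : ℕ) :
    iteratedDeriv j (fun s => L (γ s)) s = L (iteratedDeriv j γ s) := by
  rw [iteratedDeriv_eq_iteratedFDeriv, iteratedDeriv_eq_iteratedFDeriv]
  have := L.iteratedFDeriv_comp_left (x := s) (i := j) (n := j) hγ.contDiffAt le_rfl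
  exact congrArg (fun M => M fun _ => 1) this

/-- The coefficients of the Taylor expansion of the curve of lines near `ℓ`. -/
def jetCoeff (m n : ℂ) : ℕ → Fin 6 → ℂ
  | 0 => ![1, 0, 0, 0, 0, 0]
  | 1 => ![0, 0, 0, 0, 0, 1]
  | 2 => ![0, -m, -n, -(m + n), -(m + n), 0]
  | 3 => ![0, -m ^ 2, -n ^ 2, -(2 * m * n + m ^ 2), -(2 * m * n + n ^ 2), 0]
  | _ => ![0, -(m ^ 3 + m * m ^ 2), -(n ^ 3 + n * n ^ 2), -(3 * m ^ 2 * n + n * m ^ 2),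
      -(3 * m * n ^ 2 + m * n ^ 2), 0]

theorem eq_smul_sum {m n : ℂ} {u k : Fin 4 → ℂ} {s : ℂ}
    (h : u = -(s ^ 2 • quadCoeff m n) - s ^ 3 • cubicCoeff m n + s ^ 4 • k) :
    (![1, u 0, u 1, u 2, u 3, s] : Fin 6 → ℂ) =
      ∑ i ∈ Finset.range 4, s ^ i • jetCoeff m n i + s ^ 4 • ![0, k 0, k 1, k 2, k 3, 0] := by
  subst h
  ext i
  fin_cases i <;> simp [Finset.sum_range_succ, jetCoeff, quadCoeff, cubicCoeff] <;> ring

/-- Near `ℓ_x`, the cone over the VMRT of the quartic is the cone over a graph, with known jet. -/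
theorem exists_isConeGraph {a b c d : ℂ} (h : a * d - b * c = 1) (x : ell)
    (hx : ![a, b, 0, 0, 0, 0, 0] ∈ x.1.submodule) :
    ∃ (y t : TX quartic x.1 →L[ℂ] ℂ) (γ : ℂ → TX quartic x.1),
      IsConeGraph (vmrt quartic x.1) (ellDirection x) y t γ ∧
      ∃ coord : TX quartic x.1 →ₗ[ℂ] (Fin 6 → ℂ), Function.Injective coord ∧
        (∀ θ, a ^ 3 * coord θ 1 + b ^ 3 * coord θ 2 + a ^ 2 * b * coord θ 3
          + a * b ^ 2 * coord θ 4 = 0) ∧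
        ∀ j ≤ 4, coord (iteratedDeriv j γ 0) = (j.factorial : ℂ) • jetCoeff (-b) a j := by
  have h0 : (![a, b, 0, 0, 0, 0, 0] : Fin 7 → ℂ) ≠ 0 := by
    intro h0
    have ha : a = 0 := congrFun h0 0
    have hb : b = 0 := congrFun h0 1
    simp [ha, hb] at h
  obtain ⟨coord, hinj, hcoord, hrel⟩ := exists_coord h hx h0
  have hfd : FiniteDimensional ℂ (TX quartic x.1) := FiniteDimensional.of_injective coord hinj
  let e : x.1.submodule := ⟨_, hx⟩
  have he : e ≠ 0 := fun h => h0 (congrArg Subtype.val h)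
  obtain ⟨Λ, hΛ⟩ := exists_toTP he
  -- A linear retraction onto T_x X makes γ a total function; only its values on vectors tangent to
  -- X matter.
  obtain ⟨π, hπ⟩ := (TX quartic x.1).subtype.exists_leftInverse_of_injective (ker_subtype _)
  let M : (Fin 7 → ℂ) →L[ℂ] TX quartic x.1 := LinearMap.toContinuousLinearMap (π ∘ₗ Λ)
  have hM : ∀ v ∈ affineTangent quartic x.1, (M v : TP x.1) e = x.1.submodule.mkQ v := by
    intro v hv
    have hm : Λ v ∈ TX quartic x.1 := by
      rw [mem_homTo_iff hx h0]
      change Λ v e ∈ _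
      rw [hΛ]
      exact mem_map_of_mem hv
    have h1 : M v = ⟨Λ v, hm⟩ := LinearMap.congr_fun hπ ⟨Λ v, hm⟩
    rw [h1]
    exact hΛ v
  obtain ⟨U, hU, hU0, hUeq⟩ := exists_implicit (-b) a
  have hUs : ∀ᶠ s in 𝓝 (0 : ℂ), lineEq (-b) a (U s) s = 0 := by
    have hc : Tendsto (fun s => (U s, s)) (𝓝 (0 : ℂ)) (𝓝 0) := by
      have : ContinuousAt (fun s => (U s, s)) (0 : ℂ) := hU.continuousAt.prodMk continuousAt_id
      simpa only [ContinuousAt, hU0] using! this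
    filter_upwards [hc.eventually hUeq] with s hs
    exact hs.2 rfl
  let vec : ℂ → Fin 7 → ℂ := fun s => ![c, d, U s 0, U s 1, U s 2, U s 3, s]
  have hUi : ∀ i, AnalyticAt ℂ (fun s => U s i) 0 := (analyticAt_pi_iff).1 hU
  have hvec : AnalyticAt ℂ vec 0 := by
    refine (analyticAt_pi_iff).2 fun i => ?_
    fin_cases i
    exacts [analyticAt_const, analyticAt_const, hUi 0, hUi 1, hUi 2, hUi 3, analyticAt_id]
  let γ : ℂ → TX quartic x.1 := fun s => M (vec s)
  have hγ : AnalyticAt ℂ γ 0 := (M.analyticAt _).fun_comp hvec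
  -- Evaluate the binary cubic at (X, Y) = (a, b): all terms but the one linear in u contain r = -bX
  -- + aY and vanish, leaving the equation of the tangent space.
  have hvecT : ∀ s, lineEq (-b) a (U s) s = 0 → vec s ∈ affineTangent quartic x.1 := by
    intro s hs
    rw [mem_affineTangent_quartic hx h0]
    have h1 := fun i => congrFun hs i
    have e0 := h1 0
    have e1 := h1 1
    have e2 := h1 2
    have e3 := h1 3
    simp [lineEq, quadPart, cubicPart, quadCoeff, cubicCoeff, quarticCoeff, Fin.sum_univ_four,
      -Matrix.add_cons, -Matrix.cons_add] at e0 e1 e2 e3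
    change a ^ 3 * U s 0 + b ^ 3 * U s 1 + a ^ 2 * b * U s 2 + a * b ^ 2 * U s 3 = 0
    linear_combination a ^ 3 * e0 + b ^ 3 * e1 + a ^ 2 * b * e2 + a * b ^ 2 * e3
  have hγcoord : ∀ s, lineEq (-b) a (U s) s = 0 →
      coord (γ s) = ![1, U s 0, U s 1, U s 2, U s 3, s] := by
    intro s hs
    rw [hcoord _ _ (hM _ (hvecT s hs))]
    simp [quotCoord, vec, h]
  let C : TX quartic x.1 →L[ℂ] (Fin 6 → ℂ) := LinearMap.toContinuousLinearMap coord
  have hC : ∀ θ, C θ = coord θ := fun _ => rfl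
  let y : TX quartic x.1 →L[ℂ] ℂ := (ContinuousLinearMap.proj 0).comp C
  let t : TX quartic x.1 →L[ℂ] ℂ := (ContinuousLinearMap.proj 5).comp C
  have hy : ∀ θ, y θ = coord θ 0 := fun _ => rfl
  have ht : ∀ θ, t θ = coord θ 5 := fun _ => rfl
  have hyγ : ∀ᶠ s in 𝓝 (0 : ℂ), y (γ s) = 1 := by
    filter_upwards [hUs] with s hs
    rw [hy, hγcoord s hs]; rfl
  have htγ : ∀ᶠ s in 𝓝 (0 : ℂ), t (γ s) = s := by
    filter_upwards [hUs] with s hs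
    rw [ht, hγcoord s hs]; rfl
  have hy0 : y (γ 0) = 1 := hyγ.self_of_nhds
  have ht0 : t (γ 0) = 0 := htγ.self_of_nhds
  have hmem : γ 0 ∈ (ellDirection x).submodule := by
    rw [ellDirection, lineDirection, Projectivization.submodule_mk'']
    refine (mem_homTo_iff hx h0).2 ?_
    change (M (vec 0) : TP x.1) e ∈ _
    rw [hM _ (hvecT 0 hUs.self_of_nhds)]
    refine mem_map_of_mem fun i hi => ?_
    simp only [vec, hU0]
    fin_cases i <;> first | rfl | exact absurd hi (by decide)
  have hdiv : t (γ 0) / y (γ 0) = 0 := by rw [ht0, zero_div]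
  refine ⟨y, t, γ, ⟨hmem, ht0, ?_⟩, coord, hinj, hrel, ?_⟩
  · refine ⟨by rw [hy0]; exact one_ne_zero, by rwa [hdiv], by rwa [hdiv], by rwa [hdiv], ?_,
      ⟨_, ⟨_, isLineThrough_ell x.2, rfl⟩, hmem⟩⟩
    let u : TX quartic x.1 → Fin 4 → ℂ := fun θ i => coord θ i.castSucc.succ / y θ
    have hcont : ContinuousAt (fun θ => (u θ, t θ / y θ)) (γ 0) := by
      have hy1 : y (γ 0) ≠ 0 := by rw [hy0]; exact one_ne_zero
      refine ContinuousAt.prodMk (continuousAt_pi.2 fun i => ?_)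
        (t.continuous.continuousAt.div y.continuous.continuousAt hy1)
      exact ((continuous_apply _).comp C.continuous).continuousAt.div y.continuous.continuousAt hy1
    have hu0 : u (γ 0) = 0 := by
      funext i
      simp only [u, hγcoord 0 hUs.self_of_nhds, hU0]
      fin_cases i <;> simp
    have htend : Tendsto (fun θ => (u θ, t θ / y θ)) (𝓝 (γ 0)) (𝓝 0) := by
      simpa only [ContinuousAt, hu0, hdiv] using! hcont
    have htend2 : Tendsto (fun θ => t θ / y θ) (𝓝 (γ 0)) (𝓝 0) :=
      (continuous_snd.tendsto _).comp htend
    filter_upwards [htend.eventually hUeq, htend2.eventually hUs,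
      y.continuous.continuousAt.eventually_ne (show y (γ 0) ≠ 0 by rw [hy0]; exact one_ne_zero)]
      with θ h1 h2 h3
    have hθ0 : θ ≠ 0 := by rintro rfl; exact h3 (map_zero y)
    set τ := t θ / y θ with hτ
    set w : Fin 7 → ℂ := ![c, d, u θ 0, u θ 1, u θ 2, u θ 3, τ] with hw
    have hcw : coord θ = y θ • quotCoord a b w := by
      ext i
      fin_cases i
      · simp [quotCoord, hw, h, hy]
      all_goals
        simp [quotCoord, hw, u, hτ]
        field_simp
        try rfl
    -- After division by its y-coordinate, θ is represented by the vector (c, d, u, τ) of the affine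
    -- chart, and the equations of lines apply.
    have hv : (θ : TP x.1) e = x.1.submodule.mkQ (y θ • w) := by
      obtain ⟨v, hv⟩ := x.1.submodule.mkQ_surjective ((θ : TP x.1) e)
      rw [← hv, ← sub_eq_zero, ← map_sub, mkQ_apply, Quotient.mk_eq_zero]
      have h4 : quotCoord a b (v - y θ • w) = 0 := by
        rw [map_sub, map_smul, ← hcw, hcoord θ v hv.symm, sub_self]
      rw [quotCoord_eq_zero_iff h] at h4
      exact (span_singleton_le_iff_mem _ _).2 hx h4
    rw [mem_affineCone_vmrt hθ0 he hv]
    have h5 : (∀ s r : ℂ, MvPolynomial.eval (s • (e : Fin 7 → ℂ) + r • y θ • w) quartic = 0) ↔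
        lineEq (-b) a (u θ) τ = 0 := by
      rw [← eval_quartic_line_iff h]
      constructor
      · intro H s r
        have := H s (r / y θ)
        rwa [smul_smul, div_mul_cancel₀ _ h3] at this
      · intro H s r
        rw [smul_smul]
        exact H _ _
    rw [h5, h1]
    have h6 : quotCoord a b w = ![1, u θ 0, u θ 1, u θ 2, u θ 3, τ] := by
      simp [quotCoord, hw, h]
    rw [← hinj.eq_iff, map_smul, hcw, hγcoord τ h2, h6, (smul_right_injective _ h3).eq_iff]
    constructor
    · intro h7
      rw [h7]
    · intro h7
      funext i
      have := congrFun h7 i.castSucc.succ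
      fin_cases i <;> exact this
  · intro j hj
    obtain ⟨K, hK, hK0, hKeq⟩ := exists_jet (-b) a hU hU0 hUs
    have hKi : ∀ i, AnalyticAt ℂ (fun s => K s i) 0 := (analyticAt_pi_iff).1 hK
    have hKa : AnalyticAt ℂ (fun s => (![0, K s 0, K s 1, K s 2, K s 3, 0] : Fin 6 → ℂ)) 0 := by
      refine (analyticAt_pi_iff).2 fun i => ?_
      fin_cases i
      exacts [analyticAt_const, hKi 0, hKi 1, hKi 2, hKi 3, analyticAt_const]
    have h1 := iteratedDeriv_clm_comp C hγ j
    simp only [hC] at h1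
    rw [← h1]
    refine iteratedDeriv_of_eventuallyEq hKa ?_ ?_ hj
    · rw [hK0]
      ext i
      fin_cases i <;> simp [jetCoeff, quarticCoeff, quadPart, quadCoeff]
    · filter_upwards [hUs, hKeq] with s hs hs'
      rw [hγcoord s hs]
      exact eq_smul_sum hs'

/-! ### The normal bundle of ℓ via linear syzygies -/

section NormalBundleOfEll

theorem eq_vec_of_mem_ellCone {p : Fin 7 → ℂ} (hp : p ∈ ellCone) :
    p = ![p 0, p 1, 0, 0, 0, 0, 0] := by
  ext i
  fin_cases i
  · rfl
  · rfl
  all_goals exact hp _ (by decide)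

theorem ne_zero_of_mem_ellCone {p : Fin 7 → ℂ} (hp : p ∈ ellCone) (hp0 : p ≠ 0) :
    p 0 ≠ 0 ∨ p 1 ≠ 0 := by
  by_contra! hcon
  apply hp0
  rw [eq_vec_of_mem_ellCone hp, hcon.1, hcon.2]
  ext i; fin_cases i <;> rfl

/-- The linear syzygies of `x_0^3, x_0^2 x_1, x_0 x_1^2, x_1^3` give vectors which are normal to
`ℓ` and tangent to the quartic. -/
def normVec (g : ℂ) (h : Fin 3 → ℂ) (p : Fin 7 → ℂ) : Fin 7 → ℂ :=
  ![0, 0, h 0 * p 1, -(h 2 * p 0), h 1 * p 1 - h 0 * p 0, h 2 * p 1 - h 1 * p 0, g]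

theorem normVec_add (g g' : ℂ) (h h' : Fin 3 → ℂ) (p : Fin 7 → ℂ) :
    normVec (g + g') (h + h') p = normVec g h p + normVec g' h' p := by
  ext i; fin_cases i <;> simp [normVec] <;> ring

theorem normVec_smul (r g : ℂ) (h : Fin 3 → ℂ) (p : Fin 7 → ℂ) :
    normVec (r * g) (r • h) p = r • normVec g h p := by
  ext i; fin_cases i <;> simp [normVec] <;> ring

/-- This homogeneity accounts for the splitting type: g must scale like a linear form on the
tautological line, giving 𝒪(1), while h is unchanged, giving 𝒪^3. -/
theorem normVec_smul_right (r g : ℂ) (h : Fin 3 → ℂ) (p : Fin 7 → ℂ) :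
    normVec (r * g) h (r • p) = r • normVec g h p := by
  ext i; fin_cases i <;> simp [normVec] <;> ring

variable {x : ℙ ℂ (Fin 7 → ℂ)}

theorem normVec_mem_affineTangent (hx : x ∈ ell) {p : Fin 7 → ℂ} (hp : p ∈ x.submodule)
    (hp0 : p ≠ 0) (g : ℂ) (h : Fin 3 → ℂ) : normVec g h p ∈ affineTangent quartic x := by
  have h1 := eq_vec_of_mem_ellCone (hx hp)
  rw [mem_affineTangent_quartic (h1 ▸ hp) (h1 ▸ hp0)]
  simp [normVec]
  ring

/-- Pointwise exactness of the syzygies. The system is triangular: it is solved by dividing by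
whichever of X, Y is nonzero, and the tangency equation takes care of the remaining condition. -/
theorem exists_normVec {X Y : ℂ} (h0 : X ≠ 0 ∨ Y ≠ 0) {v : Fin 7 → ℂ}
    (hv : X ^ 3 * v 2 + Y ^ 3 * v 3 + X ^ 2 * Y * v 4 + X * Y ^ 2 * v 5 = 0) :
    ∃ h : Fin 3 → ℂ, v 2 = h 0 * Y ∧ v 3 = -(h 2 * X) ∧ v 4 = h 1 * Y - h 0 * X ∧
      v 5 = h 2 * Y - h 1 * X := by
  by_cases hY : Y = 0
  · have hX : X ≠ 0 := by simpa [hY] using h0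
    subst hY
    refine ⟨![-v 4 / X, -v 5 / X, -v 3 / X], ?_, ?_, ?_, ?_⟩
    · simpa [hX] using hv
    all_goals simp; field_simp
  · refine ⟨![v 2 / Y, (v 4 + v 2 / Y * X) / Y, (v 5 + (v 4 + v 2 / Y * X) / Y * X) / Y],
      ?_, ?_, ?_, ?_⟩
    · simp; field_simp
    · simp; field_simp; linear_combination hv
    all_goals simp; field_simp; ring

theorem eq_zero_of_normVec {X Y : ℂ} (h0 : X ≠ 0 ∨ Y ≠ 0) {h : Fin 3 → ℂ} (e2 : h 0 * Y = 0)
    (e3 : -(h 2 * X) = 0) (e4 : h 1 * Y - h 0 * X = 0) (e5 : h 2 * Y - h 1 * X = 0) : h = 0 := by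
  have : h 0 = 0 ∧ h 1 = 0 ∧ h 2 = 0 := by
    by_cases hY : Y = 0
    · have hX : X ≠ 0 := by simpa [hY] using h0
      subst hY
      simp_all
    · have a0 : h 0 = 0 := by simpa [hY] using e2
      have a1 : h 1 = 0 := by simpa [hY, a0] using e4
      have a2 : h 2 = 0 := by simpa [hY, a1] using e5
      exact ⟨a0, a1, a2⟩
  ext i
  fin_cases i
  exacts [this.1, this.2.1, this.2.2]

theorem mkQ_normal_eq_iff (hx : x ∈ ell) {p : x.submodule} (hp : p ≠ 0) {θ η : TX quartic x}
    {v w : Fin 7 → ℂ} (hv : (θ : TP x) p = x.submodule.mkQ v)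
    (hw : (η : TP x) p = x.submodule.mkQ w) :
    ((homTo x ellCone).submoduleOf (TX quartic x)).mkQ θ =
      ((homTo x ellCone).submoduleOf (TX quartic x)).mkQ η ↔ ∀ i : Fin 7, 2 ≤ i → v i = w i := by
  have hp' : (p : Fin 7 → ℂ) ≠ 0 := fun h => hp (Subtype.ext h)
  rw [← sub_eq_zero, ← map_sub, mkQ_apply, Quotient.mk_eq_zero]
  have h1 : θ - η ∈ (homTo x ellCone).submoduleOf (TX quartic x) ↔
      ((θ : TP x) - η) ∈ homTo x ellCone := Iff.rfl
  have h2 : ((θ : TP x) - η) p = (θ : TP x) p - (η : TP x) p := rfl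
  rw [h1, mem_homTo_iff p.2 hp']
  change ((θ : TP x) - η) p ∈ _ ↔ _
  rw [h2, hv, hw, ← map_sub]
  have h3 : x.submodule.mkQ (v - w) ∈ ellCone.map x.submodule.mkQ ↔ v - w ∈ ellCone := by
    refine ⟨?_, fun h => mem_map_of_mem h⟩
    rintro ⟨u, hu, huv⟩
    rw [← sub_eq_zero, ← map_sub, mkQ_apply, Quotient.mk_eq_zero] at huv
    rw [← sub_sub_cancel u (v - w)]
    exact sub_mem hu (hx huv)
  rw [h3]
  exact forall₂_congr fun i _ => sub_eq_zero

theorem exists_TX_apply_eq {n : ℕ} {f : MvPolynomial (Fin n) ℂ} {x : ℙ ℂ (Fin n → ℂ)}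
    {p : x.submodule} (hp : p ≠ 0) {v : Fin n → ℂ} (hv : v ∈ affineTangent f x) :
    ∃ θ : TX f x, (θ : TP x) p = x.submodule.mkQ v := by
  obtain ⟨θ, hθ⟩ := exists_apply_eq hp (x.submodule.mkQ v)
  refine ⟨⟨θ, (mem_homTo_iff p.2 fun h => hp (Subtype.ext h)).2 ?_⟩, hθ⟩
  change θ p ∈ _
  rw [hθ]
  exact mem_map_of_mem hv

/-- The map is constructed at one representative e of x. By homogeneity of `normVec` the same
formula holds at every nonzero p over x, which is what the comparison of holomorphic sections needs.
-/
theorem exists_splitEquiv (x : ell) : ∃ ψ : SplitFiber 1 3 ellCone x ≃ₗ[ℂ]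
    NormalFiber quartic ellCone x, ∀ (s : SplitFiber 1 3 ellCone x) (p : x.1.submodule), p ≠ 0 →
      ∀ (θ : TX quartic x.1) (v : Fin 7 → ℂ), (θ : TP x.1) p = x.1.submodule.mkQ v →
        (ψ s = ((homTo x.1 ellCone).submoduleOf (TX quartic x.1)).mkQ θ ↔
          ∀ i : Fin 7, 2 ≤ i → normVec (s.1 0 p) s.2 p i = v i) := by
  let e : x.1.submodule := ⟨x.1.rep, x.1.submodule_eq ▸ mem_span_singleton_self _⟩
  have he' : (e : Fin 7 → ℂ) ≠ 0 := x.1.rep_nonzero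
  have he : e ≠ 0 := fun h => he' (congrArg Subtype.val h)
  have hmem := fun g h => normVec_mem_affineTangent x.2 e.2 he' g h
  have hXY := ne_zero_of_mem_ellCone (x.2 e.2) he'
  choose F hF using fun s : SplitFiber 1 3 ellCone x =>
    exists_TX_apply_eq (f := quartic) he (hmem (s.1 0 e) s.2)
  let Fl : SplitFiber 1 3 ellCone x →ₗ[ℂ] TX quartic x.1 :=
    { toFun := F
      map_add' := fun s s' => Subtype.ext <| TP.ext_of_ne_zero he <| by
        have : ((F s + F s' : TX quartic x.1) : TP x.1) e = (F s : TP x.1) e + (F s' : TP x.1) e :=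
          rfl
        rw [this, hF, hF, hF, ← map_add, ← normVec_add]
        rfl
      map_smul' := fun r s => Subtype.ext <| TP.ext_of_ne_zero he <| by
        have : ((r • F s : TX quartic x.1) : TP x.1) e = r • (F s : TP x.1) e := rfl
        rw [RingHom.id_apply, this, hF, hF, ← map_smul, ← normVec_smul]
        rfl }
  let ψ : SplitFiber 1 3 ellCone x →ₗ[ℂ] NormalFiber quartic ellCone x :=
    ((homTo x.1 ellCone).submoduleOf (TX quartic x.1)).mkQ ∘ₗ Fl
  have hinj : Function.Injective ψ := by
    rw [← LinearMap.ker_eq_bot, LinearMap.ker_eq_bot']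
    intro s hs
    have h1 : ((homTo x.1 ellCone).submoduleOf (TX quartic x.1)).mkQ (F s) =
        ((homTo x.1 ellCone).submoduleOf (TX quartic x.1)).mkQ 0 := by
      rw [map_zero]; exact hs
    have h2 := (mkQ_normal_eq_iff x.2 he (hF s) (w := 0) (by rw [map_zero]; rfl)).1 h1
    refine Prod.ext ?_ (eq_zero_of_normVec hXY (h2 2 (by decide)) (h2 3 (by decide))
      (h2 4 (by decide)) (h2 5 (by decide)))
    funext i
    obtain rfl : i = 0 := Subsingleton.elim _ _
    refine LinearMap.ext fun q => ?_
    obtain ⟨r, rfl⟩ := (finrank_eq_one_iff_of_nonzero' e he).1 x.1.finrank_submodule q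
    have h3 : s.1 0 e = 0 := h2 6 (by decide)
    rw [map_smul, h3, smul_zero]
    rfl
  have hsurj : Function.Surjective ψ := by
    intro N
    obtain ⟨θ, rfl⟩ := mkQ_surjective _ N
    obtain ⟨v, hv, hvθ⟩ := θ.2 e
    have h1 := eq_vec_of_mem_ellCone (x.2 e.2)
    obtain ⟨h, e2, e3, e4, e5⟩ := exists_normVec hXY
      ((mem_affineTangent_quartic (h1 ▸ e.2) (h1 ▸ he')).1 hv)
    obtain ⟨χ, hχ⟩ := SeparatingDual.exists_eq_one (R := ℂ) he
    refine ⟨(fun _ => v 6 • χ.toLinearMap, h), ?_⟩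
    refine (mkQ_normal_eq_iff x.2 he (hF _) hvθ.symm).2 fun i hi => ?_
    fin_cases i
    · exact absurd hi (by decide)
    · exact absurd hi (by decide)
    · exact e2.symm
    · exact e3.symm
    · exact e4.symm
    · exact e5.symm
    · change v 6 * χ e = v 6
      rw [hχ, mul_one]
  refine ⟨LinearEquiv.ofBijective ψ ⟨hinj, hsurj⟩, fun s p hp θ v hv => ?_⟩
  have hFp : (F s : TP x.1) p = x.1.submodule.mkQ (normVec (s.1 0 p) s.2 p) := by
    obtain ⟨r, rfl⟩ := (finrank_eq_one_iff_of_nonzero' e he).1 x.1.finrank_submodule p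
    rw [map_smul, map_smul, hF, ← map_smul, coe_smul, smul_eq_mul, normVec_smul_right]
  exact mkQ_normal_eq_iff x.2 hp hFp hv

theorem analyticAt_normVec {g : (Fin 7 → ℂ) → ℂ} {h : (Fin 7 → ℂ) → Fin 3 → ℂ} {p : Fin 7 → ℂ}
    (hg : AnalyticAt ℂ g p) (hh : AnalyticAt ℂ h p) :
    AnalyticAt ℂ (fun q => normVec (g q) (h q) q) p := by
  have hhi : ∀ i, AnalyticAt ℂ (fun q => h q i) p := (analyticAt_pi_iff).1 hh
  have hq : ∀ i, AnalyticAt ℂ (fun q : Fin 7 → ℂ => q i) p := (analyticAt_pi_iff).1 analyticAt_id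
  refine (analyticAt_pi_iff).2 fun i => ?_
  fin_cases i
  · exact analyticAt_const
  · exact analyticAt_const
  · exact (hhi 0).mul (hq 1)
  · exact ((hhi 2).mul (hq 0)).neg
  · exact ((hhi 1).mul (hq 1)).sub ((hhi 0).mul (hq 0))
  · exact ((hhi 2).mul (hq 1)).sub ((hhi 1).mul (hq 0))
  · exact hg

/-- The triangular system is solved with analytic coefficients, from k 2 downwards where the
coordinate x_0 is invertible and from k 0 upwards where x_1 is. -/
theorem exists_analytic_of_normVec {p : Fin 7 → ℂ} (hp : p 0 ≠ 0 ∨ p 1 ≠ 0)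
    {v : (Fin 7 → ℂ) → Fin 7 → ℂ} (hv : AnalyticAt ℂ v p) :
    ∃ h : (Fin 7 → ℂ) → Fin 3 → ℂ, AnalyticAt ℂ h p ∧ ∀ᶠ q in 𝓝 p, ∀ (g : ℂ) (k : Fin 3 → ℂ),
      (∀ i : Fin 7, 2 ≤ i → normVec g k q i = v q i) → k = h q := by
  have hvi : ∀ i, AnalyticAt ℂ (fun q => v q i) p := (analyticAt_pi_iff).1 hv
  have hq : ∀ i, AnalyticAt ℂ (fun q : Fin 7 → ℂ => q i) p := (analyticAt_pi_iff).1 analyticAt_id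
  have key : ∀ (g : ℂ) (k : Fin 3 → ℂ) (q : Fin 7 → ℂ),
      (∀ i : Fin 7, 2 ≤ i → normVec g k q i = v q i) → k 0 * q 1 = v q 2 ∧ -(k 2 * q 0) = v q 3 ∧
        k 1 * q 1 - k 0 * q 0 = v q 4 ∧ k 2 * q 1 - k 1 * q 0 = v q 5 := fun g k q H =>
    ⟨H 2 (by decide), H 3 (by decide), H 4 (by decide), H 5 (by decide)⟩
  have hne : ∀ i, p i ≠ 0 → ∀ᶠ q in 𝓝 p, q i ≠ 0 := fun i hi =>
    (hq i).continuousAt.eventually_ne hi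
  rcases hp with h0 | h1
  · let k2 : (Fin 7 → ℂ) → ℂ := fun q => -v q 3 / q 0
    let k1 : (Fin 7 → ℂ) → ℂ := fun q => (k2 q * q 1 - v q 5) / q 0
    let k0 : (Fin 7 → ℂ) → ℂ := fun q => (k1 q * q 1 - v q 4) / q 0
    have a2 : AnalyticAt ℂ k2 p := (hvi 3).neg.div (hq 0) h0
    have a1 : AnalyticAt ℂ k1 p := ((a2.mul (hq 1)).sub (hvi 5)).div (hq 0) h0
    have a0 : AnalyticAt ℂ k0 p := ((a1.mul (hq 1)).sub (hvi 4)).div (hq 0) h0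
    refine ⟨fun q => ![k0 q, k1 q, k2 q], (analyticAt_pi_iff).2 fun i => ?_, ?_⟩
    · fin_cases i
      exacts [a0, a1, a2]
    · filter_upwards [hne 0 h0] with q hq0 g k H
      obtain ⟨-, e3, e4, e5⟩ := key g k q H
      have b2 : k 2 = k2 q := by
        rw [eq_div_iff hq0, ← e3, neg_neg]
      have b1 : k 1 = k1 q := by
        rw [eq_div_iff hq0, ← b2, ← e5]; ring
      have b0 : k 0 = k0 q := by
        rw [eq_div_iff hq0, ← b1, ← e4]; ring
      ext i
      fin_cases i
      exacts [b0, b1, b2]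
  · let k0 : (Fin 7 → ℂ) → ℂ := fun q => v q 2 / q 1
    let k1 : (Fin 7 → ℂ) → ℂ := fun q => (v q 4 + k0 q * q 0) / q 1
    let k2 : (Fin 7 → ℂ) → ℂ := fun q => (v q 5 + k1 q * q 0) / q 1
    have a0 : AnalyticAt ℂ k0 p := (hvi 2).div (hq 1) h1
    have a1 : AnalyticAt ℂ k1 p := ((hvi 4).add (a0.mul (hq 0))).div (hq 1) h1
    have a2 : AnalyticAt ℂ k2 p := ((hvi 5).add (a1.mul (hq 0))).div (hq 1) h1
    refine ⟨fun q => ![k0 q, k1 q, k2 q], (analyticAt_pi_iff).2 fun i => ?_, ?_⟩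
    · fin_cases i
      exacts [a0, a1, a2]
    · filter_upwards [hne 1 h1] with q hq1 g k H
      obtain ⟨e2, -, e4, e5⟩ := key g k q H
      have b0 : k 0 = k0 q := by
        rw [eq_div_iff hq1, ← e2]
      have b1 : k 1 = k1 q := by
        rw [eq_div_iff hq1, ← b0, ← e4]; ring
      have b2 : k 2 = k2 q := by
        rw [eq_div_iff hq1, ← b1, ← e5]; ring
      ext i
      fin_cases i
      exacts [b0, b1, b2]

theorem normalBundleIso_ell : NormalBundleIso quartic ellCone 1 3 := by
  choose ψ hψ using exists_splitEquiv
  refine ⟨fun x => (ψ x).symm, fun σ x => ?_⟩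
  obtain ⟨τ, rfl⟩ : ∃ τ : ∀ x : ell, SplitFiber 1 3 ellCone x, σ = fun x => ψ x (τ x) :=
    ⟨fun x => (ψ x).symm (σ x), by simp⟩
  simp only [LinearEquiv.symm_apply_apply]
  constructor
  · rintro ⟨p₀, hp₀, hp₀0, v, hv, H⟩
    have h0 := ne_zero_of_mem_ellCone (x.2 hp₀) hp₀0
    obtain ⟨h, hh, hheq⟩ := exists_analytic_of_normVec h0 hv
    refine ⟨p₀, hp₀, hp₀0, fun p _ => v p 6, h, ?_, hh, ?_⟩
    · exact (analyticAt_pi_iff).2 fun _ => (analyticAt_pi_iff).1 hv 6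
    · filter_upwards [H, hheq, eventually_ne_nhds hp₀0] with p H1 H2 hp0 y hp
      obtain ⟨θ, hθ, hθy⟩ := H1 y hp
      have h3 := (hψ y (τ y) ⟨p, hp⟩ (fun h => hp0 (congrArg Subtype.val h)) θ _ hθ).1 hθy
      refine ⟨fun i => ?_, H2 _ _ h3⟩
      obtain rfl : i = 0 := Subsingleton.elim _ _
      exact h3 6 (by decide)
  · rintro ⟨p₀, hp₀, hp₀0, g, h, hg, hh, H⟩
    refine ⟨p₀, hp₀, hp₀0, fun p => normVec (g p 0) (h p) p,
      analyticAt_normVec ((analyticAt_pi_iff).1 hg 0) hh, ?_⟩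
    filter_upwards [H, eventually_ne_nhds hp₀0] with p H1 hp0 y hp
    have hp' : (⟨p, hp⟩ : y.1.submodule) ≠ 0 := fun h => hp0 (congrArg Subtype.val h)
    obtain ⟨h1, h2⟩ := H1 y hp
    obtain ⟨θ, hθ⟩ := exists_TX_apply_eq hp'
      (normVec_mem_affineTangent y.2 hp hp0 (g p 0) (h p))
    refine ⟨θ, hθ, (hψ y (τ y) _ hp' θ _ hθ).2 fun i _ => ?_⟩
    rw [h1, h2]

end NormalBundleOfEll

/-! ### Linear independence of the derivatives -/

section JetIndependence

/-- Orders 0 and 1 are separated by the first and last entries. For orders 2 and 3 this is the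
independence of r(X² + XY + Y²) and r²(X + Y), with r = mX + nY ≠ 0. -/
theorem linearIndependent_jetCoeff {m n : ℂ} (h : m ≠ 0 ∨ n ≠ 0) :
    LinearIndependent ℂ fun j : Fin 4 => jetCoeff m n j := by
  rw [Fintype.linearIndependent_iff]
  intro g hg
  have h0 := congrFun hg 0
  have h1 := congrFun hg 1
  have h2 := congrFun hg 2
  have h3 := congrFun hg 3
  have h4 := congrFun hg 4
  have h5 := congrFun hg 5
  simp [Fin.sum_univ_four, jetCoeff] at h0 h1 h2 h3 h4 h5
  -- These combinations eliminate g 2, because both mixed entries of `quadCoeff` are the sum m + n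
  -- of the other two.
  have q1 : m * n * g 3 * 2 = n ^ 2 * g 3 := by linear_combination h1 + h2 - h3
  have q2 : m * n * g 3 * 2 = m ^ 2 * g 3 := by linear_combination h1 + h2 - h4
  have hn3 : n ^ 3 * g 3 = 0 := by
    linear_combination (2 / 3 * m - n) * q1 + 4 / 3 * n * q2
  have hm3 : m ^ 3 * g 3 = 0 := by
    linear_combination (2 / 3 * n - m) * q2 + 4 / 3 * m * q1
  have h23 : g 2 = 0 ∧ g 3 = 0 := by
    rcases h with h | h
    · have k3 : g 3 = 0 := by simpa [h] using hm3
      exact ⟨by simpa [h, k3] using h1, k3⟩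
    · have k3 : g 3 = 0 := by simpa [h] using hn3
      exact ⟨by simpa [h, k3] using h2, k3⟩
  intro i
  fin_cases i
  exacts [h0, h5, h23.1, h23.2]

theorem linearIndependent_jetCoeff_neg_one_one :
    LinearIndependent ℂ fun j : Fin 5 => jetCoeff (-1) 1 j := by
  rw [Fintype.linearIndependent_iff]
  intro g hg
  have h0 := congrFun hg 0
  have h1 := congrFun hg 1
  have h2 := congrFun hg 2
  have h3 := congrFun hg 3
  have h4 := congrFun hg 4
  have h5 := congrFun hg 5
  simp [Fin.sum_univ_five, jetCoeff] at h0 h1 h2 h3 h4 h5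
  norm_num at h1 h2 h3 h4
  have k4 : g 4 = 0 := by linear_combination (h4 - h3) / 8
  have k3 : g 3 = 0 := by linear_combination (h4 + h3) / 2
  have k2 : g 2 = 0 := by linear_combination h1 + k3 - 2 * k4
  intro i
  fin_cases i
  exacts [h0, h5, k2, k3, k4]

end JetIndependence

theorem linearIndependent_iteratedDeriv {W : Type*} [NormedAddCommGroup W] [NormedSpace ℂ W]
    {γ : ℂ → W} {coord : W →ₗ[ℂ] (Fin 6 → ℂ)} {m n : ℂ} {k : ℕ}
    (hli : LinearIndependent ℂ fun j : Fin k => jetCoeff m n j)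
    (hγ : ∀ j < k, coord (iteratedDeriv j γ 0) = (j.factorial : ℂ) • jetCoeff m n j) :
    LinearIndependent ℂ fun j : Fin k => iteratedDeriv j γ 0 := by
  refine LinearIndependent.of_comp coord ?_
  have h1 := hli.units_smul fun j : Fin k =>
    Units.mk0 (Nat.factorial j : ℂ) (Nat.cast_ne_zero.2 (Nat.factorial_ne_zero _))
  convert h1 using 1
  funext j
  exact hγ j j.2

theorem iteratedDeriv_notMem_jetSpan {W : Type*} [NormedAddCommGroup W] [NormedSpace ℂ W]
    {γ : ℂ → W} {k l : ℕ} (hkl : k + 2 ≤ l)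
    (hli : LinearIndependent ℂ fun j : Fin l => iteratedDeriv j γ 0) :
    iteratedDeriv (k + 1) γ 0 ∉ jetSpan γ k 0 := by
  have h1 : LinearIndependent ℂ fun j : Fin (k + 2) => iteratedDeriv j γ 0 :=
    hli.comp (Fin.castLE hkl) (Fin.castLE_injective _)
  exact (linearIndependent_finSucc'.1 h1).2

theorem exists_isConeGraph_of_mem_ell (x : ell) :
    ∃ (y t : TX quartic x.1 →L[ℂ] ℂ) (γ : ℂ → TX quartic x.1),
      IsConeGraph (vmrt quartic x.1) (ellDirection x) y t γ ∧
      (LinearIndependent ℂ fun j : Fin 4 => iteratedDeriv j γ 0) ∧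
      FiniteDimensional ℂ (TX quartic x.1) := by
  have hmem : x.1.rep ∈ x.1.submodule := x.1.submodule_eq ▸ mem_span_singleton_self _
  have hrep := eq_vec_of_mem_ellCone (x.2 hmem)
  set a := x.1.rep 0
  set b := x.1.rep 1
  have h0 : a ≠ 0 ∨ b ≠ 0 := ne_zero_of_mem_ellCone (x.2 hmem) x.1.rep_nonzero
  obtain ⟨c, d, hcd⟩ : ∃ c d, a * d - b * c = 1 := by
    rcases h0 with h | h
    · exact ⟨0, a⁻¹, by simp [h]⟩
    · exact ⟨-b⁻¹, 0, by simp [h]⟩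
  obtain ⟨y, t, γ, hγ, coord, hinj, -, hj⟩ := exists_isConeGraph hcd x (hrep ▸ hmem)
  exact ⟨y, t, γ, hγ, linearIndependent_iteratedDeriv
    (linearIndependent_jetCoeff (by simpa [or_comm] using h0)) fun j hj' => hj j hj'.le,
    FiniteDimensional.of_injective coord hinj⟩

theorem exists_isConeGraph_pointP :
    ∃ (y t : TX quartic pointP.1 →L[ℂ] ℂ) (γ : ℂ → TX quartic pointP.1),
      IsConeGraph (vmrt quartic pointP.1) (ellDirection pointP) y t γ ∧
      (LinearIndependent ℂ fun j : Fin 5 => iteratedDeriv j γ 0) ∧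
      FiniteDimensional ℂ (TX quartic pointP.1) ∧ jetSpan γ 4 0 = ⊤ := by
  have hmem : ![1, 1, 0, 0, 0, 0, 0] ∈ pointP.1.submodule := mem_span_singleton_self _
  obtain ⟨y, t, γ, hγ, coord, hinj, hrel, hj⟩ :=
    exists_isConeGraph (a := 1) (b := 1) (c := 0) (d := 1) (by ring) pointP hmem
  have hli := linearIndependent_iteratedDeriv linearIndependent_jetCoeff_neg_one_one
    fun j hj' => hj j (Nat.le_of_lt_succ hj')
  have hfd : FiniteDimensional ℂ (TX quartic pointP.1) := FiniteDimensional.of_injective coord hinj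
  refine ⟨y, t, γ, hγ, hli, hfd, ?_⟩
  -- The tangency relation at P has all coefficients 1, so coordinate 4 is determined by coordinates
  -- 1, 2, 3 and may be dropped. The dimension is thus at most five, and five independent
  -- derivatives span.
  let D : TX quartic pointP.1 →ₗ[ℂ] (Fin 5 → ℂ) :=
    (LinearMap.funLeft ℂ ℂ ![0, 1, 2, 3, 5]) ∘ₗ coord
  have hD : Function.Injective D := by
    rw [← LinearMap.ker_eq_bot, LinearMap.ker_eq_bot']
    intro θ hθ
    have h' : ∀ i, D θ i = 0 := fun i => by rw [hθ]; rfl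
    have e0 : coord θ 0 = 0 := h' 0
    have e1 : coord θ 1 = 0 := h' 1
    have e2 : coord θ 2 = 0 := h' 2
    have e3 : coord θ 3 = 0 := h' 3
    have e5 : coord θ 5 = 0 := h' 4
    have e4 : coord θ 4 = 0 := by
      have := hrel θ
      simpa [e1, e2, e3] using this
    apply hinj
    rw [map_zero]
    ext i
    fin_cases i
    exacts [e0, e1, e2, e3, e4, e5]
  have hle : finrank ℂ (TX quartic pointP.1) ≤ 5 := by
    simpa using LinearMap.finrank_le_finrank_of_injective hD
  apply eq_top_of_finrank_eq
  refine le_antisymm (finrank_le _) ?_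
  rw [jetSpan, finrank_span_eq_card hli]
  simpa using hle

/-! ### Smoothness along ℓ and elementary properties of the quartic form -/

theorem isSmoothPoint_of_mem_ell {x : ℙ ℂ (Fin 7 → ℂ)} (hx : x ∈ ell) :
    IsSmoothPoint quartic x := by
  refine ⟨fun p hp => eval_quartic_of_mem p (hx hp), fun p hp hp0 => ?_⟩
  have h1 := eq_vec_of_mem_ellCone (hx hp)
  have h2 := ne_zero_of_mem_ellCone (hx hp) hp0
  have h3 : ∀ i, MvPolynomial.eval p (MvPolynomial.pderiv i quartic) =
      (![0, 0, p 0 ^ 3, p 1 ^ 3, p 0 ^ 2 * p 1, p 0 * p 1 ^ 2, 0] : Fin 7 → ℂ) i := fun i => by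
    have := eval_pderiv_quartic 1 (p 0) (p 1) i
    rwa [one_smul, ← h1, one_pow, one_mul] at this
  rcases h2 with h | h
  · exact ⟨2, by rw [h3]; simpa using h⟩
  · exact ⟨3, by rw [h3]; simpa using h⟩

theorem isHomogeneous_quartic : quartic.IsHomogeneous 4 := by
  have hX : ∀ (i : Fin 7) (k : ℕ), (MvPolynomial.X i ^ k : MvPolynomial (Fin 7) ℂ).IsHomogeneous k :=
    fun i k => MvPolynomial.isHomogeneous_X_pow i k
  have hX1 : ∀ i : Fin 7, (MvPolynomial.X i : MvPolynomial (Fin 7) ℂ).IsHomogeneous 1 :=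
    fun i => MvPolynomial.isHomogeneous_X ℂ i
  unfold quartic
  refine .add (.add (.add (.add (.add (.add (.add (.add (.add (.add ?_ ?_) ?_) ?_) ?_) ?_) ?_) ?_)
    ?_) ?_) ?_
  · exact .add (.add (.add (.add (hX 2 4) (hX 3 4)) (hX 4 4)) (hX 5 4)) (hX 6 4)
  · exact (hX 0 3).mul (hX1 2)
  · exact (hX 1 3).mul (hX1 3)
  · exact ((hX 0 2).mul (hX1 1)).mul (hX1 4)
  · exact ((hX1 0).mul (hX 1 2)).mul (hX1 5)
  · exact (hX 0 2).mul (hX 2 2)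
  · exact (hX 1 2).mul (hX 3 2)
  · exact (((hX 0 2).add ((hX1 0).mul (hX1 1))).add (hX 1 2)).mul (hX 6 2)
  · exact (hX1 0).mul (hX 4 3)
  · exact (hX1 1).mul (hX 5 3)
  · exact ((hX1 0).add (hX1 1)).mul (hX 6 3)

theorem quartic_ne_zero : quartic ≠ 0 := by
  intro h
  have := congrArg (MvPolynomial.eval ![0, 0, 1, 0, 0, 0, 0]) h
  simp [quartic] at this

theorem rename_quartic : MvPolynomial.rename coordInvolution quartic = quartic := by
  have h : ⇑coordInvolution = ![1, 0, 3, 2, 5, 4, 6] := by decide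
  simp only [quartic, h, map_add, map_mul, map_pow, MvPolynomial.rename_X]
  simp
  ring

end

end LinesOnHypersurfaces

theorem theorem6p2 :
    -- `f` is a non-zero quartic form, invariant under the involution of the coordinates
    (quartic.IsHomogeneous 4 ∧ quartic ≠ 0 ∧ coordInvolution * coordInvolution = 1 ∧
      MvPolynomial.rename coordInvolution quartic = quartic) ∧
    -- `ℓ` is a projective line on `X`
    (Module.finrank ℂ ellCone = 2 ∧ ell ⊆ hypersurface quartic) ∧
    -- `X` is smooth along `ℓ`
    (∀ x ∈ ell, IsSmoothPoint quartic x) ∧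
    -- the normal bundle of `ℓ` in `X` is isomorphic to `𝒪(1) ⊕ 𝒪^3`
    NormalBundleIso quartic ellCone 1 3 ∧
    -- for all `x` in `ℓ`, the germ of `𝒞_x` at `ℓ_x` is a submanifold of dimension one
    (∀ x : ell, IsSubmanifoldAt (vmrt quartic x.1) (ellDirection x) 1) ∧
    -- the second fundamental form is non-zero at all points of `ℓ`
    (∀ x : ell, ellDirection x ∈ domFF 2 (vmrt quartic x.1) ∧
      fundamentalForm 2 (vmrt quartic x.1) (ellDirection x) ≠ 0) ∧
    -- the third fundamental form is non-zero at all points of `ℓ`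
    (∀ x : ell, ellDirection x ∈ domFF 3 (vmrt quartic x.1) ∧
      fundamentalForm 3 (vmrt quartic x.1) (ellDirection x) ≠ 0) ∧
    -- the fourth fundamental form is non-zero at `P`, and `𝒞_P` is linearly nondegenerate
    (ellDirection pointP ∈ domFF 4 (vmrt quartic pointP.1) ∧
      fundamentalForm 4 (vmrt quartic pointP.1) (ellDirection pointP) ≠ 0 ∧
      IsLinearlyNondegenerateAt (vmrt quartic pointP.1) (ellDirection pointP)) := by
  refine ⟨⟨isHomogeneous_quartic, quartic_ne_zero, by decide, rename_quartic⟩,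
    ⟨finrank_ellCone, fun x hx p hp => eval_quartic_of_mem p (hx hp)⟩,
    fun x hx => isSmoothPoint_of_mem_ell hx, normalBundleIso_ell, fun x => ?_, fun x => ?_,
    fun x => ?_, ?_⟩
  · obtain ⟨y, t, γ, h, -, hfd⟩ := exists_isConeGraph_of_mem_ell x
    exact h.isSubmanifoldAt
  · obtain ⟨y, t, γ, h, hli, hfd⟩ := exists_isConeGraph_of_mem_ell x
    exact ⟨h.mem_domFF (hli.comp (Fin.castLE (by norm_num)) (Fin.castLE_injective _)),
      h.fundamentalForm_ne_zero (iteratedDeriv_notMem_jetSpan (k := 1) (by norm_num) hli)⟩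
  · obtain ⟨y, t, γ, h, hli, hfd⟩ := exists_isConeGraph_of_mem_ell x
    exact ⟨h.mem_domFF (hli.comp (Fin.castLE (by norm_num)) (Fin.castLE_injective _)),
      h.fundamentalForm_ne_zero (iteratedDeriv_notMem_jetSpan (k := 2) (by norm_num) hli)⟩
  · obtain ⟨y, t, γ, h, hli, hfd, htop⟩ := exists_isConeGraph_pointP
    exact ⟨h.mem_domFF (hli.comp (Fin.castLE (by norm_num)) (Fin.castLE_injective _)),
      h.fundamentalForm_ne_zero (iteratedDeriv_notMem_jetSpan (k := 3) (by norm_num) hli),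
      h.isLinearlyNondegenerateAt htop⟩
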